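/- Let a Lie group $G$ (not necessarily compact) with Lie algebra $\mathfrak g$ act smoothly and properly on a manifold $M$, and let $X,Y$ be two smooth $G$-invariant vector fields on $M$ that are isomorphic: there is a smooth map $\psi:M\to\mathfrak g$ with $\psi(g\cdot m)=\mathrm{Ad}(g)\psi(m)$ for all $g\in G$, $m\in M$, such that $X=Y+\psi_M$, where $\psi_M(m)=\frac{d}{dt}\big|_{t=0}\exp(t\psi(m))\cdot m$. Let $\Phi^X_t,\Phi^Y_t$ be the (maximal, local) flows of $X$ and $Y$. Then: 1. $X$ and $Y$ induce the same flow on the orbit space $M/G$: there is one local flow $\Psi_t$ on $M/G$ such that, for $Z=X$ and for $Z=Y$ and all $t\in\mathbb R$, $m\in M$, $\Psi_t([m])$ is defined if and only if $\Phi^Z_t(m)$ is, and then $\Psi_t([m])=[\Phi^Z_t(m)]$. 2. $X$ and $Y$ have the same relative equilibria. (A point $x$ is a relative equilibrium of $Z$ if $Z(x)$ is tangent to the orbit $G\cdot x$.) 3. $X$ and $Y$ have the same relative periodic orbits. (A relative periodic orbit of $Z$ is a set $\{g\cdot\Phi^Z_t(x) : g\in G,\ t\in\mathbb R,\ \Phi^Z_t(x)\text{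 defined}\}$, where $x$ is not a relative equilibrium of $Z$ and $\Phi^Z_T(x)\in G\cdot x$ for some $T>0$.) 4. A point $x$ is a hyperbolic relative equilibrium of $X$ if and only if it is a hyperbolic relative equilibrium of $Y$. Here a relative equilibrium $x$ of $Z$ is hyperbolic if the orbit $G\cdot x$, which the flow of $Z$ preserves, is normally hyperbolic in the following sense: the linearized flow $T\Phi^Z_t$ on the normal bundle $N=TM|_{G\cdot x}/T(G\cdot x)$ is uniformly hyperbolic, that is, $N=N^s\oplus N^u$ with $T\Phi^Z_t$-invariant summands and there are constants $C,a>0$ with $\|T\Phi^Z_t v\|\le Ce^{-at}\|v\|$ for $v\in N^s$, $t\ge 0$, and $\|T\Phi^Z_{-t} v\|\le Ce^{-at}\|v\|$ for $v\in N^u$, $t\ge 0$, where $\|\cdot\|$ is the quotient norm of a $G$-invariant Riemannian metric on $M$. 5. If the orbit $G\cdot x$ is compact, the same equivalence holds for normal hyperbolicity in the sense that is usual for compact invariant manifolds: $x$ is a relative equilibrium of $Z$ and $TM|_{G\cdot x}=T(G\cdot x)\oplus E^s\oplus E^u$ with $T\Phi^Z_t$-invariant $E^s,E^u$ such that, for a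 Riemannian metric on $M$ and some constants $C>0$, $a>b\ge 0$, one has $\|T\Phi^Z_t v\|\le Ce^{-at}\|v\|$ for $v\in E^s$, $t\ge0$; $\|T\Phi^Z_{-t} v\|\le Ce^{-at}\|v\|$ for $v\in E^u$, $t\ge0$; and $\|T\Phi^Z_{t} v\|\le Ce^{b|t|}\|v\|$ for $v\in T(G\cdot x)$, $t\in\mathbb R$. -/

import Mathlib

open scoped Manifold ContDiff

noncomputable section

namespace EquivariantDynamics

section Fields

variable {E : Type*} [NormedAddCommGroup E] [NormedSpace ℝ E]
  {M : Type*} [TopologicalSpace M] [ChartedSpace E M]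

/-- `γ` is an integral curve of `X` with `γ 0 = m`, defined on an open interval that contains
both `0` and `t`. -/
def IsFlowCurve (X : (m : M) → TangentSpace 𝓘(ℝ, E) m) (t : ℝ) (m : M) (γ : ℝ → M) : Prop :=
  γ 0 = m ∧ ∃ a b : ℝ, 0 ∈ Set.Ioo a b ∧ t ∈ Set.Ioo a b ∧ IsMIntegralCurveOn γ X (Set.Ioo a b)

open Classical in
/-- The time-`t` map of the flow of `X`, as a total function: it is the value at time `t` of the
integral curve of `X` that starts at `m` wherever this curve lives up to time `t`
(and, by convention, `m` elsewhere). -/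
def flowMap (X : (m : M) → TangentSpace 𝓘(ℝ, E) m) (t : ℝ) (m : M) : M :=
  if h : ∃ γ, IsFlowCurve X t m γ then h.choose t else m

/-- The maximal local flow of `X`: `flow X t` is the partially defined map `Φ_t`, whose domain
consists of the points whose integral curve lives up to time `t`. -/
def flow (X : (m : M) → TangentSpace 𝓘(ℝ, E) m) (t : ℝ) : M →. M :=
  fun m => ⟨∃ γ, IsFlowCurve X t m γ, fun _ => flowMap X t m⟩

/-- The differential `T_m Φ_t` of the time-`t` map of the flow of `X`. -/
def flowDeriv (X : (m : M) → TangentSpace 𝓘(ℝ, E) m) (t : ℝ) (m : M) :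
    TangentSpace 𝓘(ℝ, E) m →L[ℝ] TangentSpace 𝓘(ℝ, E) (flowMap X t m) :=
  mfderiv 𝓘(ℝ, E) 𝓘(ℝ, E) (flowMap X t) m

/-- Smooth Riemannian metrics on `M`. -/
abbrev Metric (E : Type*) [NormedAddCommGroup E] [NormedSpace ℝ E]
    (M : Type*) [TopologicalSpace M] [ChartedSpace E M] [IsManifold 𝓘(ℝ, E) ∞ M] :=
  Bundle.ContMDiffRiemannianMetric 𝓘(ℝ, E) ∞ E (TangentSpace 𝓘(ℝ, E) : M → Type _)

/-- The length of a tangent vector. -/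
def Metric.length [IsManifold 𝓘(ℝ, E) ∞ M] (μ : Metric E M) (m : M)
    (v : TangentSpace 𝓘(ℝ, E) m) : ℝ :=
  Real.sqrt (μ.inner m v v)

end Fields

section Actions

variable {F : Type*} [NormedAddCommGroup F] [NormedSpace ℝ F]
  {G : Type*} [TopologicalSpace G] [ChartedSpace F G] [Group G]
  {E : Type*} [NormedAddCommGroup E] [NormedSpace ℝ E]
  {M : Type*} [TopologicalSpace M] [ChartedSpace E M] [MulAction G M]

/-- The adjoint action of `g` on the Lie algebra, the differential at `1` of `h ↦ g h g⁻¹`. -/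
def Ad (g : G) : GroupLieAlgebra 𝓘(ℝ, F) G →L[ℝ] GroupLieAlgebra 𝓘(ℝ, F) G :=
  (mfderiv 𝓘(ℝ, F) 𝓘(ℝ, F) (fun h : G => g * h * g⁻¹) 1 : F →L[ℝ] F)

variable (F G E) in
/-- The infinitesimal action at `m`, the differential at `1` of the evaluation map `a ↦ a • m`.
It sends `ξ` to `ξ_M(m)`, the derivative at `t = 0` of `exp(tξ) • m`. -/
def infAction (m : M) : GroupLieAlgebra 𝓘(ℝ, F) G →L[ℝ] TangentSpace 𝓘(ℝ, E) m :=
  (mfderiv 𝓘(ℝ, F) 𝓘(ℝ, E) (fun a : G => a • m) 1 : F →L[ℝ] E)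

variable (F G E) in
/-- The tangent space at `m` to the orbit `G • m`. -/
def orbitTangent (m : M) : Submodule ℝ (TangentSpace 𝓘(ℝ, E) m) :=
  LinearMap.range (infAction F G E m).toLinearMap

variable (G) in
/-- Smooth `G`-invariant vector fields on `M`. -/
structure IsInvariantVectorField [IsManifold 𝓘(ℝ, E) ∞ M]
    (X : (m : M) → TangentSpace 𝓘(ℝ, E) m) : Prop where
  smooth : ContMDiff 𝓘(ℝ, E) 𝓘(ℝ, E).tangent ∞
    (fun m => (⟨m, X m⟩ : TangentBundle 𝓘(ℝ, E) M))
  invariant : ∀ (g : G) (m : M),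
    mfderiv 𝓘(ℝ, E) 𝓘(ℝ, E) (fun y : M => g • y) m (X m) = X (g • m)

/-- Smooth equivariant maps from `M` to the Lie algebra of `G`. -/
structure IsEquivariantLieMap (E : Type*) [NormedAddCommGroup E] [NormedSpace ℝ E]
    [ChartedSpace E M] (ψ : M → GroupLieAlgebra 𝓘(ℝ, F) G) : Prop where
  smooth : ContMDiff 𝓘(ℝ, E) 𝓘(ℝ, F) ∞ (M' := F) ψ
  equivariant : ∀ (g : G) (m : M), ψ (g • m) = Ad g (ψ m)

variable (F G) in
/-- `X` and `Y` are isomorphic: `X = Y + ψ_M` for a smooth equivariant `ψ : M → 𝔤`. -/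
def Isomorphic (X Y : (m : M) → TangentSpace 𝓘(ℝ, E) m) : Prop :=
  ∃ ψ : M → GroupLieAlgebra 𝓘(ℝ, F) G, IsEquivariantLieMap E ψ ∧
    ∀ m, X m = Y m + infAction F G E m (ψ m)

variable (G) in
/-- The (local) flow of `X` descends to the (local) flow `Ψ` on the orbit space `M/G`: for all `t`
and `m`, `Ψ_t [m]` is defined if and only if `Φ_t(m)` is, and then `Ψ_t [m] = [Φ_t(m)]`. -/
def InducesOnOrbitSpace (X : (m : M) → TangentSpace 𝓘(ℝ, E) m)
    (Ψ : ℝ → MulAction.orbitRel.Quotient G M →. MulAction.orbitRel.Quotient G M) : Prop :=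
  ∀ (t : ℝ) (m : M), Ψ t (Quotient.mk (MulAction.orbitRel G M) m) =
    (flow X t m).map (Quotient.mk (MulAction.orbitRel G M))

variable (F G) in
/-- `x` is a relative equilibrium of `X`: the vector `X(x)` is tangent to the orbit of `x`. -/
def IsRelativeEquilibrium (X : (m : M) → TangentSpace 𝓘(ℝ, E) m) (x : M) : Prop :=
  X x ∈ orbitTangent F G E x

variable (F G) in
/-- `P` is a relative periodic orbit of `X`: the union of the `G`-orbits that a trajectory of `X`
meets, where this trajectory starts at a point `x` that is not a relative equilibrium and returns
to the `G`-orbit of `x` after some positive time. -/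
def IsRelativePeriodicOrbit (X : (m : M) → TangentSpace 𝓘(ℝ, E) m) (P : Set M) : Prop :=
  ∃ x : M, ¬ IsRelativeEquilibrium F G X x ∧
    (∃ T : ℝ, 0 < T ∧ ∃ y ∈ flow X T x, y ∈ MulAction.orbit G x) ∧
    P = {z | ∃ t : ℝ, ∃ y ∈ flow X t x, z ∈ MulAction.orbit G y}

variable (G) in
/-- The Riemannian metric `μ` is `G`-invariant. -/
def Metric.IsInvariant [IsManifold 𝓘(ℝ, E) ∞ M] (μ : Metric E M) : Prop :=
  ∀ (g : G) (m : M) (v w : TangentSpace 𝓘(ℝ, E) m),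
    μ.inner (g • m) (mfderiv 𝓘(ℝ, E) 𝓘(ℝ, E) (fun y : M => g • y) m v)
      (mfderiv 𝓘(ℝ, E) 𝓘(ℝ, E) (fun y : M => g • y) m w) = μ.inner m v w

variable (F G E) in
/-- The fibre at `m` of the normal bundle of the orbit of `m`. -/
abbrev NormalSpace (m : M) : Type _ := TangentSpace 𝓘(ℝ, E) m ⧸ orbitTangent F G E m

variable (F G) in
/-- The quotient norm on the normal space to the orbit of `m`, evaluated on the class of `v`. -/
def normalLength [IsManifold 𝓘(ℝ, E) ∞ M] (μ : Metric E M) (m : M)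
    (v : TangentSpace 𝓘(ℝ, E) m) : ℝ :=
  ⨅ w : orbitTangent F G E m, μ.length m (v - w)

variable (F G) in
/-- The relative equilibrium `x` of `X` is hyperbolic: the linearized flow of `X` on the normal
bundle `N = TM|_{G•x} / T(G•x)` of the orbit of `x` is uniformly hyperbolic, with respect to the
quotient of a `G`-invariant Riemannian metric. That is, `N` splits into two invariant subbundles
`Nˢ` and `Nᵘ`; the first one is contracted at a uniform exponential rate in positive time, and the
second one in negative time. -/
def IsHyperbolicRelativeEquilibrium [IsManifold 𝓘(ℝ, E) ∞ M]
    (X : (m : M) → TangentSpace 𝓘(ℝ, E) m) (x : M) : Prop :=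
  IsRelativeEquilibrium F G X x ∧
  ∃ (μ : Metric E M) (Ns Nu : (y : M) → Submodule ℝ (NormalSpace F G E y)) (C a : ℝ),
    μ.IsInvariant G ∧ 0 < C ∧ 0 < a ∧
    ∀ y ∈ MulAction.orbit G x,
      IsCompl (Ns y) (Nu y) ∧
      (∀ (t : ℝ) (v : TangentSpace 𝓘(ℝ, E) y), (orbitTangent F G E y).mkQ v ∈ Ns y →
        (orbitTangent F G E (flowMap X t y)).mkQ (flowDeriv X t y v) ∈ Ns (flowMap X t y)) ∧
      (∀ (t : ℝ) (v : TangentSpace 𝓘(ℝ, E) y), (orbitTangent F G E y).mkQ v ∈ Nu y →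
        (orbitTangent F G E (flowMap X t y)).mkQ (flowDeriv X t y v) ∈ Nu (flowMap X t y)) ∧
      (∀ (t : ℝ) (v : TangentSpace 𝓘(ℝ, E) y), 0 ≤ t → (orbitTangent F G E y).mkQ v ∈ Ns y →
        normalLength F G μ (flowMap X t y) (flowDeriv X t y v) ≤
          C * Real.exp (-a * t) * normalLength F G μ y v) ∧
      (∀ (t : ℝ) (v : TangentSpace 𝓘(ℝ, E) y), 0 ≤ t → (orbitTangent F G E y).mkQ v ∈ Nu y →
        normalLength F G μ (flowMap X (-t) y) (flowDeriv X (-t) y v) ≤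
          C * Real.exp (-a * t) * normalLength F G μ y v)

variable (F G) in
/-- The orbit of `x` is a normally hyperbolic invariant manifold of the flow of `X` in the sense
that is usual for compact invariant manifolds: `TM` splits along the orbit into `T(G•x)` and two
flow-invariant subbundles `Eˢ` and `Eᵘ`; the flow contracts `Eˢ` in positive time and `Eᵘ` in
negative time at an exponential rate `a`, which dominates the rate `b` at which it expands or
contracts the vectors tangent to the orbit. -/
def IsNormallyHyperbolicOrbit [IsManifold 𝓘(ℝ, E) ∞ M]
    (X : (m : M) → TangentSpace 𝓘(ℝ, E) m) (x : M) : Prop :=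
  IsRelativeEquilibrium F G X x ∧
  ∃ (μ : Metric E M) (Es Eu : (y : M) → Submodule ℝ (TangentSpace 𝓘(ℝ, E) y)) (C a b : ℝ),
    0 < C ∧ 0 ≤ b ∧ b < a ∧
    ∀ y ∈ MulAction.orbit G x,
      Disjoint (Es y) (Eu y) ∧ IsCompl (orbitTangent F G E y) (Es y ⊔ Eu y) ∧
      (∀ (t : ℝ), ∀ v ∈ Es y, flowDeriv X t y v ∈ Es (flowMap X t y)) ∧
      (∀ (t : ℝ), ∀ v ∈ Eu y, flowDeriv X t y v ∈ Eu (flowMap X t y)) ∧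
      (∀ (t : ℝ), ∀ v ∈ Es y, 0 ≤ t →
        μ.length (flowMap X t y) (flowDeriv X t y v) ≤
          C * Real.exp (-a * t) * μ.length y v) ∧
      (∀ (t : ℝ), ∀ v ∈ Eu y, 0 ≤ t →
        μ.length (flowMap X (-t) y) (flowDeriv X (-t) y v) ≤
          C * Real.exp (-a * t) * μ.length y v) ∧
      (∀ (t : ℝ), ∀ v ∈ orbitTangent F G E y,
        μ.length (flowMap X t y) (flowDeriv X t y v) ≤
          C * Real.exp (b * |t|) * μ.length y v)

end Actions

end EquivariantDynamics

end

set_option linter.unusedSectionVars false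

/-! On `G × M` consider the skew product field `(g, m) ↦ (dL_g ψ(m), Y(m))` (`skewField`). The
action map `(g, m) ↦ g • m` carries it to `X`, because `X = Y + ψ_M` and `X` is invariant. It is
also invariant under left translations of `G`, so pieces of trajectories can be translated and
joined, and every trajectory of `Y` lifts for its whole lifetime. Hence `Φ^X_t(m) = g_t(m) •
Φ^Y_t(m)` with `g_t(m)` differentiable in `m` (`Isomorphic.exists_reach`,
`Isomorphic.exists_flowMap_eq`). This settles the flow on the orbit space and the relative periodic
orbits; for relative equilibria it suffices that `ψ_M` is tangent to the orbits.

Differentiating in `m` shows that `TΦ^X_t v` and `g • TΦ^Y_t v` differ by a vector tangent to the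
orbit (`Isomorphic.exists_flowD_eq`). On the normal bundle the two linearized flows thus differ by
isometries of an invariant metric, and the splitting for `X` also serves `Y` once it is known to be
`G`-invariant. That is automatic: its summands consist of the vectors whose normal length tends to
`0` in positive, respectively negative, time (`mem_iff_tendsto_nlen`).

If the orbit is compact, properness makes `G` compact, so the action distorts lengths along the
orbit by bounded factors, and `Eˢ`, `Eᵘ` are `G`-invariant because a decay rate characterizes them.
Only `T(G•x) ⊕ Eˢ` need be invariant under the flow of `Y`, so `Eˢ` has to be corrected. Moving
`TΦ^Y_t` at `x` back to `x` by group elements gives a one-parameter group `A_t` on `T_xM` that is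
bounded on `T(G•x)` and contracts `T(G•x) ⊕ Eˢ` modulo `T(G•x)`. A Sylvester equation then produces
an invariant contracted complement as a graph over `Eˢ` (`exists_invariant_complement`). The same
with time reversed treats `Eᵘ`. -/

namespace EquivariantDynamics

open Set Filter Topology _root_.Metric

open scoped NNReal

/-! ### Differentiable dependence of solutions on initial values in a normed space. -/

section NormedSpace

variable {E : Type*} [NormedAddCommGroup E] [NormedSpace ℝ E]

/-- Two-sided Grönwall inequality for a curve that vanishes at `0`. -/
theorem norm_le_of_norm_deriv_le {r r' : ℝ → E} {K δ ε : ℝ} (hK : 0 < K) (hδ : 0 ≤ δ)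
    (hr : ∀ t ∈ Ioo (-ε) ε, HasDerivAt r (r' t) t) (h0 : r 0 = 0)
    (hbound : ∀ t ∈ Ioo (-ε) ε, ‖r' t‖ ≤ K * ‖r t‖ + δ) {t : ℝ} (ht : t ∈ Ioo (-ε) ε) :
    ‖r t‖ ≤ δ * (Real.exp (K * ε) / K) := by
  have key : ∀ (s s' : ℝ → E), (∀ t ∈ Ico 0 ε, HasDerivAt s (s' t) t) → s 0 = 0 →
      (∀ t ∈ Ico 0 ε, ‖s' t‖ ≤ K * ‖s t‖ + δ) → ∀ t ∈ Ico 0 ε,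
      ‖s t‖ ≤ δ * (Real.exp (K * ε) / K) := by
    intro s s' hs hs0 hb t ht
    have h := norm_le_gronwallBound_of_norm_deriv_right_le (f := s) (f' := s') (δ := 0) (K := K)
      (ε := δ) (a := 0) (b := t)
      (fun u hu => (hs u ⟨hu.1, hu.2.trans_lt ht.2⟩).continuousAt.continuousWithinAt)
      (fun u hu => (hs u ⟨hu.1, hu.2.trans ht.2⟩).hasDerivWithinAt) (by simp [hs0])
      (fun u hu => hb u ⟨hu.1, hu.2.trans ht.2⟩) t ⟨ht.1, le_rfl⟩
    refine h.trans ?_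
    rw [gronwallBound_of_K_ne_0 hK.ne', sub_zero]
    beta_reduce
    rw [zero_mul, zero_add]
    have : Real.exp (K * t) ≤ Real.exp (K * ε) := by gcongr; exact ht.2.le
    calc δ / K * (Real.exp (K * t) - 1) ≤ δ / K * Real.exp (K * ε) := by
          gcongr; linarith
      _ = _ := by ring
  rcases le_total 0 t with h | h
  · exact key r r' (fun u hu => hr u ⟨by linarith [hu.1, hu.2], hu.2⟩) h0
      (fun u hu => hbound u ⟨by linarith [hu.1, hu.2], hu.2⟩) t ⟨h, ht.2⟩
  · have := key (fun u => r (-u)) (fun u => -r' (-u))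
      (fun u hu => by
        have h1 := hr (-u) ⟨by linarith [hu.2], by linarith [hu.1, hu.2]⟩
        simpa [Function.comp_def] using h1.scomp u (hasDerivAt_neg u)) (by simpa using h0)
      (fun u hu => by
        simpa using hbound (-u) ⟨by linarith [hu.2], by linarith [hu.1, hu.2]⟩) (-t)
      ⟨by linarith, by linarith [ht.1]⟩
    simpa using this

/-- A linear differential equation with bounded continuous coefficients has an operator-valued
solution on a small interval. -/
theorem exists_linear_ode_solution [CompleteSpace E] {B : ℝ → E →L[ℝ] E} {b ε : ℝ} (hb : 0 < b)
    (hε : 0 < ε) (hbε : 2 * b * ε ≤ 1) (hBc : ContinuousOn B (Icc (-ε) ε))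
    (hB : ∀ t ∈ Icc (-ε) ε, ‖B t‖ ≤ b) :
    ∃ D : ℝ → E →L[ℝ] E, D 0 = ContinuousLinearMap.id ℝ E ∧
      ∀ t ∈ Ioo (-ε) ε, HasDerivAt D ((B t).comp (D t)) t := by
  -- In the unit ball around the identity `‖D‖ ≤ 2`, so the speed is at most `2b`; since `2bε ≤ 1`,
  -- a solution cannot leave the ball before time `ε`.
  have hpl : IsPicardLindelof (fun t (D : E →L[ℝ] E) => (B t).comp D) (tmin := -ε) (tmax := ε)
      ⟨0, by constructor <;> linarith⟩ (ContinuousLinearMap.id ℝ E) 1 0 (2 * ⟨b, hb.le⟩)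
      ⟨b, hb.le⟩ := by
    refine ⟨fun t ht => LipschitzOnWith.of_dist_le_mul fun D _ D' _ => ?_, fun D _ => ?_,
      fun t ht D hD => ?_, ?_⟩
    · rw [dist_eq_norm, dist_eq_norm, ← ContinuousLinearMap.comp_sub]
      refine (ContinuousLinearMap.opNorm_comp_le _ _).trans ?_
      exact mul_le_mul_of_nonneg_right (hB t ht) (norm_nonneg _)
    · exact hBc.clm_comp continuousOn_const
    · have h1 : ‖D‖ ≤ 2 := by
        have h2 : ‖D - ContinuousLinearMap.id ℝ E‖ ≤ 1 := by simpa [dist_eq_norm] using hD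
        calc ‖D‖ = ‖(D - ContinuousLinearMap.id ℝ E) + ContinuousLinearMap.id ℝ E‖ := by simp
          _ ≤ _ := norm_add_le _ _
          _ ≤ 1 + 1 := add_le_add h2 ContinuousLinearMap.norm_id_le
          _ = 2 := by norm_num
      refine (ContinuousLinearMap.opNorm_comp_le _ _).trans ?_
      calc ‖B t‖ * ‖D‖ ≤ b * 2 := by gcongr; exact hB t ht
        _ = _ := by rw [mul_comm]; rfl
    · push_cast
      simp only [sub_zero, zero_sub, neg_neg, max_self]
      exact hbε
  obtain ⟨D, hD0, hD⟩ := hpl.exists_eq_forall_mem_Icc_hasDerivWithinAt₀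
  exact ⟨D, hD0, fun t ht =>
    (hD t (Ioo_subset_Icc_self ht)).hasDerivAt (Icc_mem_nhds ht.1 ht.2)⟩

/-- The quadratic Taylor estimate for a function whose derivative is Lipschitz. -/
theorem norm_sub_sub_fderiv_le {f : E → E} {s : Set E} (hs : Convex ℝ s) {K : ℝ≥0}
    (hf : ∀ x ∈ s, DifferentiableAt ℝ f x) (hK : LipschitzOnWith K (fderiv ℝ f) s)
    {x y : E} (hx : x ∈ s) (hy : y ∈ s) :
    ‖f y - f x - fderiv ℝ f x (y - x)‖ ≤ K * ‖y - x‖ ^ 2 := by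
  have hsub : segment ℝ x y ⊆ s := hs.segment_subset hx hy
  have := (convex_segment (𝕜 := ℝ) x y).norm_image_sub_le_of_norm_hasFDerivWithin_le' (f := f)
    (f' := fderiv ℝ f) (φ := fderiv ℝ f x) (C := K * ‖y - x‖)
    (fun z hz => (hf z (hsub hz)).hasFDerivAt.hasFDerivWithinAt)
    (fun z hz => by
      refine (hK.norm_sub_le (hsub hz) hx).trans ?_
      gcongr
      obtain ⟨θ, hθ, rfl⟩ := segment_eq_image' ℝ x y ▸ hz
      rw [add_sub_cancel_left, norm_smul, Real.norm_eq_abs, abs_of_nonneg hθ.1]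
      exact mul_le_of_le_one_left (norm_nonneg _) hθ.2)
    (left_mem_segment ℝ x y) (right_mem_segment ℝ x y)
  calc _ ≤ _ := this
    _ = _ := by ring

/-- A `C²` vector field has a local flow, which is differentiable in the initial point. -/
theorem exists_local_flow_differentiableAt [CompleteSpace E] {f : E → E} {x₀ : E}
    (hf : ContDiffAt ℝ 2 f x₀) {u : Set E} (hu : u ∈ 𝓝 x₀) :
    ∃ r > (0 : ℝ), ∃ ε > (0 : ℝ), ∃ φ : E → ℝ → E, ∀ x ∈ ball x₀ r, φ x 0 = x ∧
      ∀ t ∈ Ioo (-ε) ε, HasDerivAt (φ x) (f (φ x t)) t ∧ φ x t ∈ u ∧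
        DifferentiableAt ℝ (fun y => φ y t) x := by
  obtain ⟨ε₁, hε₁, a, r₁, L, K, hr₁, hpl⟩ :=
    IsPicardLindelof.of_contDiffAt_one (hf.of_le (by norm_num))
  have hpl0 := hpl 0
  obtain ⟨α, hα, L', hL'⟩ := hpl0.exists_forall_mem_closedBall_eq_hasDerivWithinAt_lipschitzOnWith
  simp only [zero_sub, zero_add] at hα hL'
  have hf' : ContDiffAt ℝ 1 (fderiv ℝ f) x₀ := hf.fderiv_right (by norm_num)
  obtain ⟨K₂, s, hs, hK₂⟩ := hf'.exists_lipschitzOnWith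
  set b : ℝ := ‖fderiv ℝ f x₀‖ + 1 with hbdef
  have hb : 0 < b := by positivity
  have hbd : ∀ᶠ x in 𝓝 x₀, ‖fderiv ℝ f x‖ < b :=
    hf'.continuousAt.norm.eventually_lt continuousAt_const (by linarith)
  have hdiff : ∀ᶠ x in 𝓝 x₀, DifferentiableAt ℝ f x :=
    (hf.eventually (by simp)).mono fun x hx => hx.differentiableAt (by norm_num)
  -- On the ball of radius `ρ` the field is differentiable, its derivative is bounded by `b` and
  -- `K₂`-Lipschitz, and points lie in `u`. The choices of `ε` and `r` keep all trajectories inside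
  -- it.
  obtain ⟨ρ, hρ, hball⟩ := Metric.mem_nhds_iff.1 (inter_mem (inter_mem hu hs) (hbd.and hdiff))
  have hα0c : ContinuousAt (α x₀) 0 :=
    (((hα x₀ (mem_closedBall_self r₁.2)).2 0 ⟨by linarith, hε₁.le⟩).hasDerivAt
      (Icc_mem_nhds (by linarith) hε₁)).continuousAt
  have hα00 : α x₀ 0 = x₀ := (hα x₀ (mem_closedBall_self r₁.2)).1
  obtain ⟨ε₂, hε₂, hαε⟩ := Metric.continuousAt_iff.1 hα0c (ρ / 2) (by positivity)
  rw [hα00] at hαε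
  -- The three bounds keep time within the Picard–Lindelöf interval, the trajectory of `x₀` within
  -- `ρ / 2` of `x₀`, and the variational equation solvable.
  set ε : ℝ := min (min (ε₁ / 2) (ε₂ / 2)) (1 / (2 * b)) with hεdef
  have hε : 0 < ε := by positivity
  have hεε₁ : ε < ε₁ := ((min_le_left _ _).trans (min_le_left _ _)).trans_lt (by linarith)
  have hεε₂ : ε < ε₂ := ((min_le_left _ _).trans (min_le_right _ _)).trans_lt (by linarith)
  have hεb : 2 * b * ε ≤ 1 := by
    calc 2 * b * ε ≤ 2 * b * (1 / (2 * b)) := by gcongr; exact min_le_right _ _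
      _ = 1 := by field_simp
  set r : ℝ := min r₁ (ρ / (2 * (L' + 1))) with hrdef
  have hr : 0 < r := lt_min hr₁ (by positivity)
  have hsub : ∀ x ∈ ball x₀ r, x ∈ closedBall x₀ (r₁ : ℝ) := fun x hx =>
    mem_closedBall.2 ((mem_ball.1 hx).le.trans (min_le_left _ _))
  have hmem : ∀ x ∈ ball x₀ r, ∀ t ∈ Icc (-ε) ε, α x t ∈ ball x₀ ρ := by
    intro x hx t ht
    have ht1 : t ∈ Icc (-ε₁) ε₁ := ⟨by linarith [ht.1], by linarith [ht.2]⟩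
    have h1 : dist (α x t) (α x₀ t) ≤ L' * dist x x₀ :=
      (hL' t ht1).dist_le_mul x (hsub x hx) x₀ (mem_closedBall_self r₁.2)
    have h2 : dist (α x₀ t) x₀ < ρ / 2 := hαε (by
      rw [Real.dist_eq, sub_zero]; exact (abs_le.2 ht).trans_lt hεε₂)
    have h3 : (L' : ℝ) * dist x x₀ ≤ ρ / 2 := by
      have h4 : dist x x₀ ≤ ρ / (2 * (L' + 1)) := (mem_ball.1 hx).le.trans (min_le_right _ _)
      calc (L' : ℝ) * dist x x₀ ≤ (L' + 1) * (ρ / (2 * (L' + 1))) := by gcongr; linarith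
        _ = ρ / 2 := by field_simp
    rw [mem_ball]
    linarith [dist_triangle (α x t) (α x₀ t) x₀]
  have hder : ∀ x ∈ ball x₀ r, ∀ t ∈ Icc (-ε) ε, HasDerivAt (α x) (f (α x t)) t := by
    intro x hx t ht
    exact ((hα x (hsub x hx)).2 t ⟨by linarith [ht.1], by linarith [ht.2]⟩).hasDerivAt
      (Icc_mem_nhds (by linarith [ht.1]) (by linarith [ht.2]))
  refine ⟨r, hr, ε, hε, α, fun x hx => ⟨(hα x (hsub x hx)).1, fun t ht =>
    ⟨hder x hx t (Ioo_subset_Icc_self ht), (hball (hmem x hx t (Ioo_subset_Icc_self ht))).1.1,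
      ?_⟩⟩⟩
  -- the variational equation along the trajectory of `x`
  have hBc : ContinuousOn (fun t => fderiv ℝ f (α x t)) (Icc (-ε) ε) :=
    hK₂.continuousOn.comp (fun t ht => (hder x hx t ht).continuousAt.continuousWithinAt)
      (fun t ht => (hball (hmem x hx t ht)).1.2)
  obtain ⟨D, hD0, hD⟩ := exists_linear_ode_solution hb hε hεb hBc
    (fun t ht => (hball (hmem x hx t ht)).2.1.le)
  have hDv : ∀ t ∈ Ioo (-ε) ε, ∀ v : E,
      HasDerivAt (fun t => D t v) ((fderiv ℝ f (α x t)).comp (D t) v) t := fun t ht v => by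
    simpa using (hD t ht).clm_apply (hasDerivAt_const t v)
  set c : ℝ := Real.exp (b * ε) / b
  -- The remainder satisfies the variational equation up to the quadratic Taylor error of `f`, which
  -- is at most `K₂ (L' ‖y - x‖)²` since the flow is `L'`-Lipschitz. Grönwall makes the remainder
  -- itself quadratic, so `D t` is the derivative.
  have hrem : ∀ y ∈ ball x₀ r, ‖α y t - α x t - D t (y - x)‖ ≤
      (K₂ * L' ^ 2 * c) * ‖y - x‖ ^ 2 := by
    intro y hy
    have := norm_le_of_norm_deriv_le (r := fun t => α y t - α x t - D t (y - x))
      (r' := fun t => f (α y t) - f (α x t) - (fderiv ℝ f (α x t)).comp (D t) (y - x))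
      (δ := K₂ * (L' * ‖y - x‖) ^ 2) (ε := ε) hb (by positivity)
      (fun t ht => ((hder y hy t (Ioo_subset_Icc_self ht)).sub
        (hder x hx t (Ioo_subset_Icc_self ht))).sub (hDv t ht _))
      (by simp [(hα x (hsub x hx)).1, (hα y (hsub y hy)).1, hD0])
      (fun t ht => by
        have htI := Ioo_subset_Icc_self ht
        have h1 := norm_sub_sub_fderiv_le (convex_ball x₀ ρ) (fun z hz => (hball hz).2.2)
          (hK₂.mono fun z hz => (hball hz).1.2) (hmem x hx t htI) (hmem y hy t htI)
        have h2 : ‖α y t - α x t‖ ≤ L' * ‖y - x‖ :=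
          (hL' t ⟨by linarith [ht.1], by linarith [ht.2]⟩).norm_sub_le (hsub y hy) (hsub x hx)
        have h3 : ‖fderiv ℝ f (α x t) (α y t - α x t - D t (y - x))‖ ≤
            b * ‖α y t - α x t - D t (y - x)‖ :=
          (ContinuousLinearMap.le_opNorm _ _).trans
            (mul_le_mul_of_nonneg_right (hball (hmem x hx t htI)).2.1.le (norm_nonneg _))
        have h4 : f (α y t) - f (α x t) - (fderiv ℝ f (α x t)).comp (D t) (y - x) =
            fderiv ℝ f (α x t) (α y t - α x t - D t (y - x)) +
            (f (α y t) - f (α x t) - fderiv ℝ f (α x t) (α y t - α x t)) := by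
          simp only [map_sub, ContinuousLinearMap.comp_apply]; abel
        rw [h4]
        refine (norm_add_le _ _).trans (add_le_add h3 (h1.trans ?_))
        gcongr) ht
    refine this.trans (le_of_eq ?_)
    ring
  have : HasFDerivAt (fun y => α y t) (D t) x := by
    refine .of_isLittleO (Asymptotics.IsBigO.trans_isLittleO ?_
      (Asymptotics.isLittleO_pow_sub_sub x (m := 2) one_lt_two))
    refine .of_bound (K₂ * L' ^ 2 * c) ?_
    filter_upwards [isOpen_ball.mem_nhds hx] with y hy
    simpa using hrem y hy
  exact this.differentiableAt

end NormedSpace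

/-! ### The flow as a relation, with uniqueness and the group law. -/

section Reach

variable {E : Type*} [NormedAddCommGroup E] [NormedSpace ℝ E]
  {H : Type*} [TopologicalSpace H] {I : ModelWithCorners ℝ E H}
  {M : Type*} [TopologicalSpace M] [ChartedSpace H M]

/-- The integral curve of `v` that starts at `p` lives up to time `t`, when it arrives at `q`. -/
def Reach (v : (m : M) → TangentSpace I m) (t : ℝ) (p q : M) : Prop :=
  ∃ γ : ℝ → M, γ 0 = p ∧ γ t = q ∧
    ∃ a b : ℝ, 0 ∈ Ioo a b ∧ t ∈ Ioo a b ∧ IsMIntegralCurveOn γ v (Ioo a b)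

variable {v : (m : M) → TangentSpace I m} {s t : ℝ} {p q q' : M}

theorem reach_of_isMIntegralCurveOn {γ : ℝ → M} {a b : ℝ}
    (hγ : IsMIntegralCurveOn γ v (Ioo a b)) (hs : s ∈ Ioo a b) (ht : t ∈ Ioo a b) :
    Reach v (t - s) (γ s) (γ t) := by
  refine ⟨γ ∘ (· + s), by simp, by simp, a - s, b - s, ⟨by linarith [hs.1], by linarith [hs.2]⟩,
    ⟨by linarith [ht.1], by linarith [ht.2]⟩, ?_⟩
  convert hγ.comp_add s using 1
  ext x
  simp only [mem_Ioo, mem_ofPred_eq]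
  constructor <;> rintro ⟨h1, h2⟩ <;> constructor <;> linarith

theorem Reach.symm (h : Reach v t p q) : Reach v (-t) q p := by
  obtain ⟨γ, rfl, rfl, a, b, h0, ht, hγ⟩ := h
  simpa using reach_of_isMIntegralCurveOn hγ ht h0

/-- Related vector fields have related integral curves. -/
theorem Reach.map {E' : Type*} [NormedAddCommGroup E'] [NormedSpace ℝ E']
    {H' : Type*} [TopologicalSpace H'] {I' : ModelWithCorners ℝ E' H'}
    {N : Type*} [TopologicalSpace N] [ChartedSpace H' N] {w : (n : N) → TangentSpace I' n}
    {f : M → N} (hf : MDifferentiable I I' f) (hvw : ∀ m, mfderiv I I' f m (v m) = w (f m))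
    (h : Reach v t p q) : Reach w t (f p) (f q) := by
  obtain ⟨γ, rfl, rfl, a, b, h0, ht, hγ⟩ := h
  refine ⟨f ∘ γ, rfl, rfl, a, b, h0, ht, fun s hs => ?_⟩
  have := (hf (γ s)).hasMFDerivAt.comp_hasMFDerivWithinAt s (hγ s hs)
  refine this.congr_mfderiv ?_
  ext
  change mfderiv I I' f (γ s) ((1 : ℝ) • v (γ s)) = (1 : ℝ) • w (f (γ s))
  rw [map_smul, hvw]

variable [IsManifold I 1 M] [BoundarylessManifold I M]

theorem Reach.eq [T2Space M] (hv : CMDiff 1 (fun m => (⟨m, v m⟩ : TangentBundle I M)))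
    (h : Reach v t p q) (h' : Reach v t p q') : q = q' := by
  obtain ⟨γ, h0, rfl, a, b, h0m, ht, hγ⟩ := h
  obtain ⟨γ', h0', rfl, a', b', h0m', ht', hγ'⟩ := h'
  exact isMIntegralCurveOn_Ioo_eqOn_of_contMDiff_boundaryless (a := max a a') (b := min b b')
    (t₀ := 0) ⟨max_lt h0m.1 h0m'.1, lt_min h0m.2 h0m'.2⟩ hv
    (hγ.mono (Ioo_subset_Ioo (le_max_left ..) (min_le_left ..)))
    (hγ'.mono (Ioo_subset_Ioo (le_max_right ..) (min_le_right ..))) (h0.trans h0'.symm)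
    ⟨max_lt ht.1 ht'.1, lt_min ht.2 ht'.2⟩

theorem Reach.trans [T2Space M] (hv : CMDiff 1 (fun m => (⟨m, v m⟩ : TangentBundle I M)))
    {r : M} (h : Reach v s p q) (h' : Reach v t q r) : Reach v (s + t) p r := by
  obtain ⟨γ, rfl, rfl, a, b, h0, hs, hγ⟩ := h
  obtain ⟨γ', h0', rfl, a', b', h0m', ht, hγ'⟩ := h'
  have hγ'' : IsMIntegralCurveOn (γ' ∘ (· + (-s))) v (Ioo (a' + s) (b' + s)) := by
    convert hγ'.comp_add (-s) using 1
    ext x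
    simp only [mem_Ioo, mem_ofPred_eq]
    constructor <;> rintro ⟨h1, h2⟩ <;> constructor <;> linarith
  have hmem : s ∈ Ioo a b ∩ Ioo (a' + s) (b' + s) :=
    ⟨hs, by linarith [h0m'.1], by linarith [h0m'.2]⟩
  have heq : γ s = (γ' ∘ (· + (-s))) s := by simp [h0']
  have hpw := isMIntegralCurveOn_piecewise hv hγ hγ'' hmem heq
  have heqOn := eqOn_piecewise_of_isMIntegralCurveOn_Ioo hv hγ hγ'' hmem heq
  have hst : s + t ∈ Ioo (a' + s) (b' + s) := ⟨by linarith [ht.1], by linarith [ht.2]⟩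
  refine ⟨(Ioo a b).piecewise γ (γ' ∘ (· + (-s))), piecewise_eq_of_mem _ _ _ h0,
    by rw [heqOn hst]; simp,
    min a (a' + s), max b (b' + s), ⟨min_lt_of_left_lt h0.1, lt_max_of_lt_left h0.2⟩,
    ⟨min_lt_of_right_lt hst.1, lt_max_of_lt_right hst.2⟩, ?_⟩
  rwa [Ioo_union_Ioo' (hmem.2.1.trans hmem.1.2) (hmem.1.1.trans hmem.2.2)] at hpw

end Reach

/-! ### Local flows on manifolds, and differentiability of the flow on its whole domain. -/

section LocalFlow

variable {E : Type*} [NormedAddCommGroup E] [NormedSpace ℝ E] [CompleteSpace E]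
  {H : Type*} [TopologicalSpace H] {I : ModelWithCorners ℝ E H}
  {M : Type*} [TopologicalSpace M] [ChartedSpace H M] [IsManifold I 1 M]
  [BoundarylessManifold I M] {v : (m : M) → TangentSpace I m}

/-- A `C²` vector field on a manifold without boundary has a local flow, which is differentiable
in the initial point. -/
theorem exists_local_flow {x₀ : M}
    (hv : CMDiffAt 2 (fun m => (⟨m, v m⟩ : TangentBundle I M)) x₀) :
    ∃ U ∈ 𝓝 x₀, ∃ ε > (0 : ℝ), ∃ Φ : ℝ → M → M, ∀ p ∈ U, ∀ t ∈ Ioo (-ε) ε,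
      Reach v t p (Φ t p) ∧ MDifferentiableAt I I (Φ t) p := by
  rw [contMDiffAt_iff] at hv
  obtain ⟨_, hv⟩ := hv
  have hx : I.IsInteriorPoint x₀ := BoundarylessManifold.isInteriorPoint
  obtain ⟨r, hr, ε, hε, φ, hφ⟩ := exists_local_flow_differentiableAt
    (hv.contDiffAt (range_mem_nhds_isInteriorPoint hx)).snd
    (isOpen_interior.mem_nhds ((I.isInteriorPoint_iff).mp hx))
  refine ⟨(extChartAt I x₀).source ∩ extChartAt I x₀ ⁻¹' ball (extChartAt I x₀ x₀) r,
    inter_mem (extChartAt_source_mem_nhds x₀)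
      ((continuousAt_extChartAt x₀).preimage_mem_nhds (ball_mem_nhds _ hr)), ε, hε,
    fun t p => (extChartAt I x₀).symm (φ (extChartAt I x₀ p) t), fun p hp t ht => ⟨?_, ?_⟩⟩
  · refine ⟨(extChartAt I x₀).symm ∘ φ (extChartAt I x₀ p), ?_, rfl, -ε, ε, ⟨by linarith, hε⟩, ht,
      ?_⟩
    · rw [Function.comp_apply, (hφ _ hp.2).1, PartialEquiv.left_inv _ hp.1]
    intro t ht
    set f := φ (extChartAt I x₀ p)
    let xₜ : M := (extChartAt I x₀).symm (f t)
    have haux := (hφ _ hp.2).2 t ht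
    have h : HasDerivAt f (x := t) <| fderivWithin ℝ (extChartAt I x₀ ∘ (extChartAt I xₜ).symm)
      (range I) (extChartAt I xₜ xₜ) (v xₜ) := haux.1
    rw [← tangentCoordChange_def] at h
    have hf3 := haux.2.1
    have hf3' := mem_of_mem_of_subset hf3 interior_subset
    have hft1 := mem_preimage.mp <|
      mem_of_mem_of_subset hf3' (extChartAt I x₀).target_subset_preimage_source
    have hft2 := mem_extChartAt_source (I := I) xₜ
    let w : E := v xₜ
    replace h : HasDerivAt f (tangentCoordChange I xₜ x₀ xₜ w) t := h
    -- `h` is the velocity in the fixed chart at `x₀`, whereas an integral curve is tested in the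
    -- chart at the moving point `xₜ`; the two coordinate changes cancel.
    have hd : HasDerivAt ((extChartAt I xₜ ∘ (extChartAt I x₀).symm) ∘ f) w t := by
      rw [← tangentCoordChange_self (I := I) (x := xₜ) (z := xₜ) (v := w) hft2,
        ← tangentCoordChange_comp (x := x₀) ⟨⟨hft2, hft1⟩, hft2⟩]
      apply HasFDerivAt.comp_hasDerivAt _ _ h
      apply HasFDerivWithinAt.hasFDerivAt (s := range I) _ <|
        mem_nhds_iff.mpr ⟨interior (extChartAt I x₀).target,
          subset_trans interior_subset (extChartAt_target_subset_range ..),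
          isOpen_interior, hf3⟩
      rw [← (extChartAt I x₀).right_inv hf3']
      exact hasFDerivWithinAt_tangentCoordChange ⟨hft1, hft2⟩
    apply HasMFDerivAt.hasMFDerivWithinAt
    refine ⟨(continuousAt_extChartAt_symm'' hf3').comp h.continuousAt, ?_⟩
    simp only [mfld_simps]
    exact hd.hasFDerivAt.hasFDerivWithinAt
  · have haux := (hφ _ hp.2).2 t ht
    have h1 : MDifferentiableAt I 𝓘(ℝ, E) (extChartAt I x₀) p :=
      mdifferentiableAt_extChartAt (by simpa using hp.1)
    have h2 : MDifferentiableAt 𝓘(ℝ, E) 𝓘(ℝ, E) (fun y => φ y t) (extChartAt I x₀ p) :=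
      haux.2.2.mdifferentiableAt
    have h3 : MDifferentiableAt 𝓘(ℝ, E) I (extChartAt I x₀).symm (φ (extChartAt I x₀ p) t) := by
      have := mdifferentiableWithinAt_extChartAt_symm (I := I)
        (interior_subset haux.2.1)
      exact this.mdifferentiableAt (mem_of_superset (isOpen_interior.mem_nhds haux.2.1)
        (interior_subset.trans (extChartAt_target_subset_range ..)))
    exact h3.comp p (h2.comp p h1)

theorem reach_zero (hv : CMDiff 2 (fun m => (⟨m, v m⟩ : TangentBundle I M))) (p : M) :
    Reach v 0 p p := by
  obtain ⟨U, hU, ε, hε, Φ, h⟩ := exists_local_flow (hv p)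
  obtain ⟨γ, h0, -, h'⟩ := (h p (mem_of_mem_nhds hU) 0 ⟨by linarith, hε⟩).1
  exact ⟨γ, h0, h0, h'⟩

/-- The flow of a `C²` vector field is defined on a neighbourhood of each point of its domain, and
is differentiable there. -/
theorem Reach.exists_mdifferentiableAt [T2Space M]
    (hv : CMDiff 2 (fun m => (⟨m, v m⟩ : TangentBundle I M))) {t : ℝ} {p q : M}
    (h : Reach v t p q) :
    ∃ Θ : M → M, (∀ᶠ p' in 𝓝 p, Reach v t p' (Θ p')) ∧ MDifferentiableAt I I Θ p := by
  have hv1 : CMDiff 1 (fun m => (⟨m, v m⟩ : TangentBundle I M)) := hv.of_le (by norm_num)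
  obtain ⟨γ, rfl, rfl, a, b, h0, ht, hγ⟩ := h
  -- The relation between times holds locally in both orders by the local flow and is transitive by
  -- composition, so connectedness of the interval gives it for all pairs. The clause `Θ (γ s) = γ
  -- s'` makes the base points match under composition.
  have key := isPreconnected_Ioo.induction₂' (s := Ioo a b)
    (fun s s' => ∃ Θ : M → M, Θ (γ s) = γ s' ∧
      (∀ᶠ p' in 𝓝 (γ s), Reach v (s' - s) p' (Θ p')) ∧ MDifferentiableAt I I Θ (γ s))
    (fun s₀ hs₀ => by
      obtain ⟨U, hU, ε, hε, Φ, h⟩ := exists_local_flow (hv (γ s₀))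
      have hγc : ContinuousWithinAt γ (Ioo a b) s₀ := hγ.continuousWithinAt hs₀
      have hU' := interior_mem_nhds.2 hU
      filter_upwards [hγc.preimage_mem_nhdsWithin hU', self_mem_nhdsWithin,
        mem_nhdsWithin_of_mem_nhds (Ioo_mem_nhds (by linarith : s₀ - ε < s₀)
          (by linarith : s₀ < s₀ + ε))] with s hsU hs hsε
      have key : ∀ s s', s ∈ Ioo a b → s' ∈ Ioo a b → γ s ∈ interior U → s' - s ∈ Ioo (-ε) ε →
          ∃ Θ : M → M, Θ (γ s) = γ s' ∧
          (∀ᶠ p' in 𝓝 (γ s), Reach v (s' - s) p' (Θ p')) ∧ MDifferentiableAt I I Θ (γ s) := by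
        intro s s' hs hs' hsU hss
        refine ⟨Φ (s' - s), ?_, ?_, (h _ (interior_subset hsU) _ hss).2⟩
        · exact (h _ (interior_subset hsU) _ hss).1.eq hv1 (reach_of_isMIntegralCurveOn hγ hs hs')
        · filter_upwards [isOpen_interior.mem_nhds hsU] with p' hp'
          exact (h _ (interior_subset hp') _ hss).1
      exact ⟨key s₀ s hs₀ hs (mem_of_mem_nhds hU') ⟨by linarith [hsε.1], by linarith [hsε.2]⟩,
        key s s₀ hs hs₀ hsU ⟨by linarith [hsε.2], by linarith [hsε.1]⟩⟩)
    (fun s₁ s₂ s₃ _ _ _ h12 h23 => by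
      obtain ⟨Θ, he, hr, hd⟩ := h12
      obtain ⟨Θ', he', hr', hd'⟩ := h23
      rw [← he] at hr' hd' he'
      refine ⟨Θ' ∘ Θ, he', ?_, hd'.comp _ hd⟩
      filter_upwards [hr, hd.continuousAt.eventually hr'] with p' h1 h2
      have := h1.trans hv1 h2
      rwa [show s₂ - s₁ + (s₃ - s₂) = s₃ - s₁ by ring] at this) h0 ht
  obtain ⟨Θ, -, h1, h2⟩ := key
  exact ⟨Θ, by simpa using h1, h2⟩

end LocalFlow

/-! ### Derivatives typed as maps of model spaces, so that equal base points can be rewritten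
freely. -/

section PlainDerivative

variable {E : Type*} [NormedAddCommGroup E] [NormedSpace ℝ E]
  {H : Type*} [TopologicalSpace H] {I : ModelWithCorners ℝ E H}
  {M : Type*} [TopologicalSpace M] [ChartedSpace H M]
  {E' : Type*} [NormedAddCommGroup E'] [NormedSpace ℝ E']
  {H' : Type*} [TopologicalSpace H'] {I' : ModelWithCorners ℝ E' H'}
  {M' : Type*} [TopologicalSpace M'] [ChartedSpace H' M']
  {E'' : Type*} [NormedAddCommGroup E''] [NormedSpace ℝ E'']
  {H'' : Type*} [TopologicalSpace H''] {I'' : ModelWithCorners ℝ E'' H''}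
  {M'' : Type*} [TopologicalSpace M''] [ChartedSpace H'' M'']

variable (I I') in
/-- The derivative of a map between manifolds, as a linear map between the model spaces. -/
noncomputable def plainDeriv (f : M → M') (x : M) : E →L[ℝ] E' := mfderiv I I' f x

theorem plainDeriv_comp {g : M' → M''} {f : M → M'} {x : M}
    (hg : MDifferentiableAt I' I'' g (f x)) (hf : MDifferentiableAt I I' f x) :
    plainDeriv I I'' (fun y => g (f y)) x =
      (plainDeriv I' I'' g (f x)).comp (plainDeriv I I' f x) :=
  mfderiv_comp x hg hf

theorem plainDeriv_congr {f g : M → M'} {x : M} (h : f =ᶠ[𝓝 x] g) :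
    plainDeriv I I' f x = plainDeriv I I' g x :=
  h.mfderiv_eq

theorem plainDeriv_id {x : M} : plainDeriv I I (fun y : M => y) x = .id ℝ E :=
  mfderiv_id

theorem plainDeriv_prodMk {f : M → M'} {g : M → M''} {x : M} (hf : MDifferentiableAt I I' f x)
    (hg : MDifferentiableAt I I'' g x) :
    plainDeriv I (I'.prod I'') (fun y => (f y, g y)) x =
      (plainDeriv I I' f x).prod (plainDeriv I I'' g x) :=
  hf.mfderiv_prod hg

theorem plainDeriv_of_prod {f : M × M' → M''} {x : M} {y : M'}
    (hf : MDifferentiableAt (I.prod I') I'' f (x, y)) (v : E) (w : E') :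
    plainDeriv (I.prod I') I'' f (x, y) (v, w) =
      plainDeriv I I'' (fun z => f (z, y)) x v + plainDeriv I' I'' (fun z => f (x, z)) y w :=
  mfderiv_prod_eq_add_apply hf

end PlainDerivative

/-! ### The derivatives of a smooth action and of left translations. -/

section Action

variable {F : Type*} [NormedAddCommGroup F] [NormedSpace ℝ F]
  {G : Type*} [TopologicalSpace G] [ChartedSpace F G] [Group G]
  {E : Type*} [NormedAddCommGroup E] [NormedSpace ℝ E]
  {M : Type*} [TopologicalSpace M] [ChartedSpace E M] [MulAction G M]

variable (E) in
/-- The derivative at `m` of the diffeomorphism by which `g` acts. -/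
noncomputable def push (g : G) (m : M) : E →L[ℝ] E :=
  plainDeriv 𝓘(ℝ, E) 𝓘(ℝ, E) (fun y : M => g • y) m

variable (F G E) in
/-- The infinitesimal action, as a linear map between the model spaces. -/
noncomputable def infAct (m : M) : F →L[ℝ] E :=
  plainDeriv 𝓘(ℝ, F) 𝓘(ℝ, E) (fun a : G => a • m) 1

variable (F) in
/-- The adjoint action, as a linear map of the model space. -/
noncomputable def adj (g : G) : F →L[ℝ] F :=
  plainDeriv 𝓘(ℝ, F) 𝓘(ℝ, F) (fun h : G => g * h * g⁻¹) 1

variable (F G E) in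
/-- The tangent space to the orbit, as a subspace of the model space. -/
noncomputable def orbitDir (m : M) : Submodule ℝ E := orbitTangent F G E m

theorem mem_orbitDir {m : M} {v : E} : v ∈ orbitDir F G E m ↔ ∃ ζ : F, infAct F G E m ζ = v :=
  Iff.rfl

section

variable [ContMDiffSMul 𝓘(ℝ, F) 𝓘(ℝ, E) ∞ G M]

variable (F E G M) in
theorem mdifferentiable_smul :
    MDifferentiable (𝓘(ℝ, F).prod 𝓘(ℝ, E)) 𝓘(ℝ, E) (fun p : G × M => p.1 • p.2) :=
  (contMDiff_smul (I := 𝓘(ℝ, F)) (I' := 𝓘(ℝ, E)) (n := ∞)).mdifferentiable (by simp)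

include F in
variable (F E M) in
theorem mdifferentiable_const_smul (g : G) :
    MDifferentiable 𝓘(ℝ, E) 𝓘(ℝ, E) (fun m : M => g • m) :=
  (mdifferentiable_smul F G E M).comp
    ((mdifferentiable_const (I' := 𝓘(ℝ, F)) (c := g)).prodMk mdifferentiable_id)

variable (F E G) in
theorem mdifferentiable_smul_const (m : M) :
    MDifferentiable 𝓘(ℝ, F) 𝓘(ℝ, E) (fun g : G => g • m) :=
  (mdifferentiable_smul F G E M).comp
    (mdifferentiable_id.prodMk (mdifferentiable_const (I' := 𝓘(ℝ, E)) (c := m)))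

include F in
variable (F) in
theorem push_mul (h g : G) (m : M) : push E (h * g) m = (push E h (g • m)).comp (push E g m) := by
  have : (fun y : M => (h * g) • y) = fun y => h • g • y := by ext; rw [mul_smul]
  rw [push, this]
  exact plainDeriv_comp (mdifferentiable_const_smul F E M h _)
    (mdifferentiable_const_smul F E M g _)

omit [TopologicalSpace G] in
theorem push_one (m : M) : push E (1 : G) m = .id ℝ E := by
  simp only [push, one_smul]
  exact plainDeriv_id

include F in
variable (F) in
theorem push_mul_apply (h g : G) (m : M) (v : E) :
    push E h (g • m) (push E g m v) = push E (h * g) m v := by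
  rw [push_mul F]; rfl

include F in
variable (F) in
theorem push_inv_push (g : G) (m : M) (v : E) :
    push E g⁻¹ (g • m) (push E g m v) = v := by
  rw [push_mul_apply F, inv_mul_cancel, push_one]; rfl

include F in
variable (F) in
theorem push_push_inv (g : G) (m : M) (v : E) :
    push E g m (push E g⁻¹ (g • m) v) = v := by
  have := push_inv_push F g⁻¹ (g • m) v
  rwa [inv_inv, inv_smul_smul] at this

/-- The derivative of the action map. -/
theorem plainDeriv_smul (g : G) (m : M) (w : F) (v : E) :
    plainDeriv (𝓘(ℝ, F).prod 𝓘(ℝ, E)) 𝓘(ℝ, E) (fun p : G × M => p.1 • p.2) (g, m) (w, v) =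
      plainDeriv 𝓘(ℝ, F) 𝓘(ℝ, E) (fun a : G => a • m) g w + push E g m v :=
  plainDeriv_of_prod (mdifferentiable_smul F G E M (g, m)) w v

end

section

variable [LieGroup 𝓘(ℝ, F) ∞ G]

theorem mdifferentiable_mul_left (g : G) :
    MDifferentiable 𝓘(ℝ, F) 𝓘(ℝ, F) (fun a : G => g * a) :=
  (contMDiff_mul_left (I := 𝓘(ℝ, F)) (n := ∞)).mdifferentiable (by simp)

theorem mdifferentiable_mul_right (g : G) :
    MDifferentiable 𝓘(ℝ, F) 𝓘(ℝ, F) (fun a : G => a * g) :=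
  (contMDiff_mul_right (I := 𝓘(ℝ, F)) (n := ∞)).mdifferentiable (by simp)

variable [ContMDiffSMul 𝓘(ℝ, F) 𝓘(ℝ, E) ∞ G M]

/-- The infinitesimal action is equivariant. -/
theorem push_infAct (g : G) (m : M) (ζ : F) :
    push E g m (infAct F G E m ζ) = infAct F G E (g • m) (adj F g ζ) := by
  have h1 : plainDeriv 𝓘(ℝ, F) 𝓘(ℝ, E) (fun a : G => g • a • m) 1 =
      (push E g m).comp (infAct F G E m) := by
    have := plainDeriv_comp (x := (1 : G)) (mdifferentiable_const_smul F E M g ((1 : G) • m))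
      (mdifferentiable_smul_const F G E m 1)
    rw [this, one_smul]; rfl
  have h2 : plainDeriv 𝓘(ℝ, F) 𝓘(ℝ, E) (fun a : G => (g * a * g⁻¹) • g • m) 1 =
      (infAct F G E (g • m)).comp (adj F g) := by
    have := plainDeriv_comp (f := fun a : G => g * a * g⁻¹) (x := (1 : G))
      (mdifferentiable_smul_const F G E (g • m) (g * 1 * g⁻¹))
      (((mdifferentiable_mul_right g⁻¹).comp (mdifferentiable_mul_left g)) 1)
    rw [this, mul_one, mul_inv_cancel]; rfl
  have h3 : (fun a : G => (g * a * g⁻¹) • g • m) = fun a : G => g • a • m := by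
    ext a; simp [mul_smul]
  rw [h3, h1] at h2
  exact DFunLike.congr_fun h2 ζ

theorem push_mem_orbitDir (g : G) {m : M} {v : E} (hv : v ∈ orbitDir F G E m) :
    push E g m v ∈ orbitDir F G E (g • m) := by
  obtain ⟨ζ, rfl⟩ := mem_orbitDir.1 hv
  exact mem_orbitDir.2 ⟨_, (push_infAct g m ζ).symm⟩

theorem push_mem_orbitDir_iff (g : G) {m : M} {v : E} :
    push E g m v ∈ orbitDir F G E (g • m) ↔ v ∈ orbitDir F G E m := by
  refine ⟨fun h => ?_, push_mem_orbitDir g⟩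
  have := push_mem_orbitDir g⁻¹ h
  rwa [push_inv_push F, inv_smul_smul] at this

/-- The derivative of an orbit map takes its values in the tangent spaces to the orbit. -/
theorem plainDeriv_orbit_mem (g : G) (m : M) (w : F) :
    plainDeriv 𝓘(ℝ, F) 𝓘(ℝ, E) (fun a : G => a • m) g w ∈ orbitDir F G E (g • m) := by
  have h := plainDeriv_comp (x := g) (mdifferentiable_smul_const F G E (g • m) (g * g⁻¹))
    (mdifferentiable_mul_right g⁻¹ g)
  rw [mul_inv_cancel] at h
  have h3 : (fun a : G => (a * g⁻¹) • g • m) = fun a : G => a • m := by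
    ext a; simp [mul_smul]
  rw [h3] at h
  exact mem_orbitDir.2 ⟨_, (DFunLike.congr_fun h w).symm⟩

/-- The derivative of an orbit map on a left invariant vector field. -/
theorem plainDeriv_orbit_mul_left (g : G) (m : M) (ζ : F) :
    plainDeriv 𝓘(ℝ, F) 𝓘(ℝ, E) (fun a : G => a • m) g
      (plainDeriv 𝓘(ℝ, F) 𝓘(ℝ, F) (fun a : G => g * a) 1 ζ) = push E g m (infAct F G E m ζ) := by
  have h1 : plainDeriv 𝓘(ℝ, F) 𝓘(ℝ, E) (fun a : G => g • a • m) 1 =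
      (push E g m).comp (infAct F G E m) := by
    have := plainDeriv_comp (x := (1 : G)) (mdifferentiable_const_smul F E M g ((1 : G) • m))
      (mdifferentiable_smul_const F G E m 1)
    rw [this, one_smul]; rfl
  have h2 := plainDeriv_comp (x := (1 : G)) (mdifferentiable_smul_const F G E m (g * 1))
    (mdifferentiable_mul_left g 1)
  simp only [mul_smul, mul_one] at h2
  rw [h1] at h2
  exact (DFunLike.congr_fun h2 ζ).symm

/-- Left invariance of the field `h ↦ dL_h ζ`; it makes the flow of the skew product commute with
left translations. -/
theorem plainDeriv_mul_left_mul (g h : G) (ζ : F) :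
    plainDeriv 𝓘(ℝ, F) 𝓘(ℝ, F) (fun a : G => g * a) h
      (plainDeriv 𝓘(ℝ, F) 𝓘(ℝ, F) (fun a : G => h * a) 1 ζ) =
      plainDeriv 𝓘(ℝ, F) 𝓘(ℝ, F) (fun a : G => g * h * a) 1 ζ := by
  have h2 := plainDeriv_comp (x := (1 : G)) (mdifferentiable_mul_left (F := F) g (h * 1))
    (mdifferentiable_mul_left (F := F) h 1)
  simp only [← mul_assoc, mul_one] at h2
  exact (DFunLike.congr_fun h2 ζ).symm

end

end Action

section LieGroup

variable {F : Type*} [NormedAddCommGroup F] [NormedSpace ℝ F]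
  {G : Type*} [TopologicalSpace G] [ChartedSpace F G] [Group G] [LieGroup 𝓘(ℝ, F) ∞ G]

-- Charts make `G` a `T₁` space, and a `T₁` topological group is Hausdorff. This gives uniqueness of
-- integral curves on `G × M`.
include F in
variable (F G) in
theorem t2Space_of_lieGroup : T2Space G := by
  have := ChartedSpace.t1Space F G
  have := topologicalGroup_of_lieGroup 𝓘(ℝ, F) ∞ (G := G)
  infer_instance

end LieGroup

/-! ### The skew product field on `G × M`. -/

section Skew

variable {F : Type*} [NormedAddCommGroup F] [NormedSpace ℝ F]
  {G : Type*} [TopologicalSpace G] [ChartedSpace F G] [Group G]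
  {E : Type*} [NormedAddCommGroup E] [NormedSpace ℝ E]
  {M : Type*} [TopologicalSpace M] [ChartedSpace E M]

/-- The vector field `(g, m) ↦ (dL_g ψ(m), Y(m))` on `G × M`. -/
noncomputable def skewField (ψ : M → F) (Y : (m : M) → TangentSpace 𝓘(ℝ, E) m) (p : G × M) :
    TangentSpace (𝓘(ℝ, F).prod 𝓘(ℝ, E)) p :=
  ((plainDeriv 𝓘(ℝ, F) 𝓘(ℝ, F) (fun a : G => p.1 * a) 1 (ψ p.2), Y p.2) : F × E)

variable [LieGroup 𝓘(ℝ, F) ∞ G] [IsManifold 𝓘(ℝ, E) ∞ M]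

/-- The inclusion of a tangent space into the tangent bundle is smooth. -/
theorem contMDiff_tangent_mk (m : M) :
    ContMDiff 𝓘(ℝ, E) 𝓘(ℝ, E).tangent ∞ (fun v : E => (⟨m, v⟩ : TangentBundle 𝓘(ℝ, E) M)) := by
  intro v
  rw [Bundle.contMDiffAt_totalSpace]
  refine ⟨contMDiffAt_const, ?_⟩
  let e := trivializationAt E (TangentSpace 𝓘(ℝ, E) : M → Type _) m
  let L : E →L[ℝ] E := e.continuousLinearMapAt ℝ m
  have hL : ∀ w : E, (e ⟨m, w⟩).2 = L w := fun w => by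
    have : m ∈ e.baseSet := FiberBundle.mem_baseSet_trivializationAt' m
    exact (congrFun (e.coe_linearMapAt_of_mem (R := ℝ) this) w).symm
  exact (L.contMDiff v).congr_of_eventuallyEq (Eventually.of_forall hL)

/-- The `G`-component is the tangent map of multiplication evaluated at the pair of vectors `0` at
`g` and `ψ m` at `1`, hence a composite of smooth maps. -/
theorem contMDiff_skewField {ψ : M → F} {Y : (m : M) → TangentSpace 𝓘(ℝ, E) m}
    (hψ : ContMDiff 𝓘(ℝ, E) 𝓘(ℝ, F) ∞ ψ)
    (hY : ContMDiff 𝓘(ℝ, E) 𝓘(ℝ, E).tangent ∞ (fun m => (⟨m, Y m⟩ : TangentBundle 𝓘(ℝ, E) M))) :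
    ContMDiff (𝓘(ℝ, F).prod 𝓘(ℝ, E)) (𝓘(ℝ, F).prod 𝓘(ℝ, E)).tangent ∞
      (fun p : G × M => (⟨p, skewField ψ Y p⟩ : TangentBundle (𝓘(ℝ, F).prod 𝓘(ℝ, E)) (G × M))) := by
  have h0 : ContMDiff (𝓘(ℝ, F).prod 𝓘(ℝ, E)) 𝓘(ℝ, F).tangent ∞
      (fun p : G × M => (⟨p.1, 0⟩ : TangentBundle 𝓘(ℝ, F) G)) :=
    (Bundle.contMDiff_zeroSection ℝ (TangentSpace 𝓘(ℝ, F) : G → Type _)).comp contMDiff_fst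
  have h1 : ContMDiff (𝓘(ℝ, F).prod 𝓘(ℝ, E)) 𝓘(ℝ, F).tangent ∞
      (fun p : G × M => (⟨1, ψ p.2⟩ : TangentBundle 𝓘(ℝ, F) G)) :=
    (contMDiff_tangent_mk 1).comp (hψ.comp contMDiff_snd)
  have h2 : ContMDiff (𝓘(ℝ, F).prod 𝓘(ℝ, F)).tangent 𝓘(ℝ, F).tangent ∞
      (tangentMap (𝓘(ℝ, F).prod 𝓘(ℝ, F)) 𝓘(ℝ, F) (fun p : G × G => p.1 * p.2)) :=
    (contMDiff_mul 𝓘(ℝ, F) ∞).contMDiff_tangentMap (by simp)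
  have h3 := (h2.comp contMDiff_equivTangentBundleProd_symm).comp (h0.prodMk h1)
  have h4 := contMDiff_equivTangentBundleProd_symm.comp (h3.prodMk (hY.comp contMDiff_snd))
  refine h4.congr fun p => ?_
  have hbase : ∀ (a b : G) (m : M) (w w' : F) (y : E), a = b → w = w' →
      (⟨(a, m), ((w, y) : F × E)⟩ : TangentBundle (𝓘(ℝ, F).prod 𝓘(ℝ, E)) (G × M)) =
        ⟨(b, m), ((w', y) : F × E)⟩ := by
    rintro a b m w w' y rfl rfl; rfl
  have hmul : plainDeriv (𝓘(ℝ, F).prod 𝓘(ℝ, F)) 𝓘(ℝ, F) (fun p : G × G => p.1 * p.2) (p.1, 1)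
      (0, ψ p.2) = plainDeriv 𝓘(ℝ, F) 𝓘(ℝ, F) (fun a : G => p.1 * a) 1 (ψ p.2) := by
    rw [plainDeriv_of_prod ((contMDiff_mul 𝓘(ℝ, F) ∞).mdifferentiable (by simp) _), map_zero,
      zero_add]
  exact hbase _ _ _ _ _ _ (mul_one p.1).symm hmul.symm

end Skew

/-! ### The total flow map, its derivative and the cocycle identity. -/

section Flow

variable {E : Type*} [NormedAddCommGroup E] [NormedSpace ℝ E] [FiniteDimensional ℝ E]
  {M : Type*} [TopologicalSpace M] [T2Space M] [ChartedSpace E M] [IsManifold 𝓘(ℝ, E) ∞ M]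

/-- The derivative of the time-`t` map of the flow, as a linear map of the model space. -/
noncomputable def flowD (X : (m : M) → TangentSpace 𝓘(ℝ, E) m) (t : ℝ) (m : M) : E →L[ℝ] E :=
  plainDeriv 𝓘(ℝ, E) 𝓘(ℝ, E) (flowMap X t) m

/-- Smoothness of a vector field. -/
def SmoothField (X : (m : M) → TangentSpace 𝓘(ℝ, E) m) : Prop :=
  ContMDiff 𝓘(ℝ, E) 𝓘(ℝ, E).tangent ∞ (fun m => (⟨m, X m⟩ : TangentBundle 𝓘(ℝ, E) M))

/-- The values of a vector field, as vectors of the model space. -/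
def fieldVec (X : (m : M) → TangentSpace 𝓘(ℝ, E) m) (m : M) : E := X m

theorem two_le_infty : (2 : WithTop ℕ∞) ≤ ∞ := ENat.LEInfty.out

variable {X : (m : M) → TangentSpace 𝓘(ℝ, E) m} {s t : ℝ} {m q r : M}

omit [FiniteDimensional ℝ E] [T2Space M] [IsManifold 𝓘(ℝ, E) ∞ M] in
theorem exists_isFlowCurve_iff : (∃ γ, IsFlowCurve X t m γ) ↔ ∃ q, Reach X t m q := by
  constructor
  · rintro ⟨γ, h0, h⟩
    exact ⟨γ t, γ, h0, rfl, h⟩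
  · rintro ⟨q, γ, h0, -, h⟩
    exact ⟨γ, h0, h⟩

omit [FiniteDimensional ℝ E] in
theorem Reach.flowMap_eq (hX : SmoothField X) (h : Reach X t m q) : flowMap X t m = q := by
  have hex := exists_isFlowCurve_iff.2 ⟨q, h⟩
  rw [flowMap, dif_pos hex]
  have : Reach X t m (hex.choose t) := ⟨_, hex.choose_spec.1, rfl, hex.choose_spec.2⟩
  exact this.eq (hX.of_le (by simp)) h

omit [FiniteDimensional ℝ E] [T2Space M] [IsManifold 𝓘(ℝ, E) ∞ M] in
theorem flowMap_of_not_reach (h : ¬ ∃ q, Reach X t m q) : flowMap X t m = m := by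
  rw [flowMap, dif_neg]
  rwa [exists_isFlowCurve_iff]

omit [FiniteDimensional ℝ E] in
theorem mem_flow_iff (hX : SmoothField X) : q ∈ flow X t m ↔ Reach X t m q := by
  constructor
  · rintro ⟨hdom, rfl⟩
    obtain ⟨q, hq⟩ := exists_isFlowCurve_iff.1 hdom
    rw [← hq.flowMap_eq hX] at hq
    exact hq
  · intro h
    exact ⟨exists_isFlowCurve_iff.2 ⟨q, h⟩, h.flowMap_eq hX⟩

/-- The domain of the flow is open, so near `m` the conventional value of `flowMap` off the domain
plays no role and `flowMap` agrees with a differentiable local flow. -/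
theorem Reach.mdifferentiableAt_flowMap (hX : SmoothField X) (h : Reach X t m q) :
    (∀ᶠ p in 𝓝 m, Reach X t p (flowMap X t p)) ∧
      MDifferentiableAt 𝓘(ℝ, E) 𝓘(ℝ, E) (flowMap X t) m := by
  have : CompleteSpace E := FiniteDimensional.complete ℝ E
  obtain ⟨Θ, h1, h2⟩ := h.exists_mdifferentiableAt (hX.of_le two_le_infty)
  have heq : flowMap X t =ᶠ[𝓝 m] Θ := h1.mono fun p hp => hp.flowMap_eq hX
  exact ⟨(h1.and heq).mono fun p hp => hp.2.symm ▸ hp.1, h2.congr_of_eventuallyEq heq⟩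

theorem flowD_zero (hX : SmoothField X) : flowD X 0 m = .id ℝ E := by
  have : CompleteSpace E := FiniteDimensional.complete ℝ E
  have : flowMap X 0 = fun p => p :=
    funext fun p => (reach_zero (hX.of_le two_le_infty) p).flowMap_eq hX
  rw [flowD, this]
  exact plainDeriv_id

theorem flowD_add (hX : SmoothField X) (h : Reach X s m q) (h' : Reach X t q r) (v : E) :
    flowD X (s + t) m v = flowD X t q (flowD X s m v) := by
  obtain ⟨h1, h2⟩ := h.mdifferentiableAt_flowMap hX
  obtain ⟨h1', h2'⟩ := h'.mdifferentiableAt_flowMap hX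
  have hq := h.flowMap_eq hX
  rw [← hq] at h1' h2'
  have heq : flowMap X (s + t) =ᶠ[𝓝 m] fun p => flowMap X t (flowMap X s p) := by
    filter_upwards [h1, h2.continuousAt.eventually h1'] with p hp hp'
    exact (hp.trans (hX.of_le (by simp)) hp').flowMap_eq hX
  rw [flowD, plainDeriv_congr heq, plainDeriv_comp h2' h2, hq]
  rfl

end Flow

/-! ### Comparison of the flows of isomorphic fields, and one-parameter subgroups. -/

section Action

variable {F : Type*} [NormedAddCommGroup F] [NormedSpace ℝ F]
  {G : Type*} [TopologicalSpace G] [ChartedSpace F G] [Group G]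
  {E : Type*} [NormedAddCommGroup E] [NormedSpace ℝ E]
  {M : Type*} [TopologicalSpace M] [ChartedSpace E M]

variable {X Y : (m : M) → TangentSpace 𝓘(ℝ, E) m} {s t : ℝ} {m q r : M}

theorem Reach.snd {ψ : M → F} {p p' : G × M} (hr : Reach (skewField ψ Y) t p p') :
    Reach Y t p.2 p'.2 :=
  hr.map mdifferentiable_snd fun p =>
    DFunLike.congr_fun (mfderiv_snd (I := 𝓘(ℝ, F)) (I' := 𝓘(ℝ, E)) (x := p)) _

variable [LieGroup 𝓘(ℝ, F) ∞ G]

/-- The skew product field is invariant under left translation of the `G`-factor, so a trajectory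
can be restarted at any group element. -/
theorem Reach.mul_left {ψ : M → F} (h : G) {g g' : G}
    (hr : Reach (skewField ψ Y) t (g, m) (g', q)) :
    Reach (skewField ψ Y) t (h * g, m) (h * g', q) := by
  have h1 : MDifferentiable (𝓘(ℝ, F).prod 𝓘(ℝ, E)) 𝓘(ℝ, F) (fun p : G × M => h * p.1) :=
    (mdifferentiable_mul_left h).comp mdifferentiable_fst
  have h2 : MDifferentiable (𝓘(ℝ, F).prod 𝓘(ℝ, E)) 𝓘(ℝ, E) (fun p : G × M => p.2) :=
    mdifferentiable_snd
  refine hr.map (f := fun p : G × M => (h * p.1, p.2)) (h1.prodMk h2) fun p => ?_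
  have e1 : plainDeriv (𝓘(ℝ, F).prod 𝓘(ℝ, E)) 𝓘(ℝ, F) (fun p : G × M => h * p.1) p =
      (plainDeriv 𝓘(ℝ, F) 𝓘(ℝ, F) (fun a : G => h * a) p.1).comp (.fst ℝ F E) :=
    (plainDeriv_comp (mdifferentiable_mul_left h p.1) mdifferentiable_fst.mdifferentiableAt).trans
      (congrArg _ (mfderiv_fst ..))
  have e2 : plainDeriv (𝓘(ℝ, F).prod 𝓘(ℝ, E)) 𝓘(ℝ, E) (fun p : G × M => p.2) p = .snd ℝ F E :=
    mfderiv_snd ..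
  have e3 := plainDeriv_prodMk (h1 p) (h2 p)
  rw [e1, e2] at e3
  refine (DFunLike.congr_fun e3 (skewField ψ Y p : F × E)).trans ?_
  exact Prod.ext (plainDeriv_mul_left_mul h p.1 (ψ p.2)) rfl

variable [MulAction G M]

omit [LieGroup 𝓘(ℝ, F) ∞ G] in
theorem Isomorphic.symm (h : Isomorphic F G X Y) : Isomorphic F G Y X := by
  obtain ⟨ψ, hψ, h⟩ := h
  refine ⟨fun m => -ψ m, ⟨hψ.smooth.neg, fun g m => ?_⟩, fun m => ?_⟩
  · rw [hψ.equivariant, map_neg]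
  · rw [map_neg, h, add_neg_cancel_right]

omit [LieGroup 𝓘(ℝ, F) ∞ G] in
theorem Isomorphic.exists_smooth (h : Isomorphic F G X Y) :
    ∃ ψ : M → F, ContMDiff 𝓘(ℝ, E) 𝓘(ℝ, F) ∞ ψ ∧
      ∀ m, fieldVec X m = fieldVec Y m + infAct F G E m (ψ m) := by
  obtain ⟨ψ, hψ, h⟩ := h
  exact ⟨ψ, hψ.smooth, h⟩

variable [IsManifold 𝓘(ℝ, E) ∞ M]

omit [TopologicalSpace G] [ChartedSpace F G] [LieGroup 𝓘(ℝ, F) ∞ G] in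
theorem IsInvariantVectorField.push_eq (hX : IsInvariantVectorField G X) (g : G) (m : M) :
    push E g m (fieldVec X m) = fieldVec X (g • m) :=
  hX.invariant g m

omit [TopologicalSpace G] [ChartedSpace F G] [LieGroup 𝓘(ℝ, F) ∞ G] in
theorem IsInvariantVectorField.smoothField (hX : IsInvariantVectorField G X) : SmoothField X :=
  hX.smooth

/-- The action map relates the skew product to `X`: the two components contribute `g • ψ_M(m)` and
`g • Y(m)`, whose sum is `g • X(m) = X(g • m)`. -/
theorem Reach.smul_of_skewField [ContMDiffSMul 𝓘(ℝ, F) 𝓘(ℝ, E) ∞ G M] {ψ : M → F}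
    (hX : IsInvariantVectorField G X)
    (hψ : ∀ m, fieldVec X m = fieldVec Y m + infAct F G E m (ψ m)) {g g' : G}
    (hr : Reach (skewField ψ Y) t (g, m) (g', q)) : Reach X t (g • m) (g' • q) := by
  refine hr.map (mdifferentiable_smul F G E M) fun p => ?_
  have h := plainDeriv_smul p.1 p.2
    (plainDeriv 𝓘(ℝ, F) 𝓘(ℝ, F) (fun a : G => p.1 * a) 1 (ψ p.2)) (fieldVec Y p.2)
  rw [plainDeriv_orbit_mul_left, ← map_add, add_comm, ← hψ, hX.push_eq] at h
  exact h

/-- For constant `ξ` the `G`-component is the left invariant field of `ξ`, and the orbit map of `x`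
carries it to `X`. The `M`-component is discarded. -/
theorem Reach.smul_of_const [ContMDiffSMul 𝓘(ℝ, F) 𝓘(ℝ, E) ∞ G M] {ξ : F} {x : M}
    (hX : IsInvariantVectorField G X) (hξ : fieldVec X x = infAct F G E x ξ) {g g' : G}
    (hr : Reach (skewField (fun _ => ξ) Y) t (g, m) (g', q)) : Reach X t (g • x) (g' • x) := by
  refine hr.map (f := fun p : G × M => p.1 • x)
    ((mdifferentiable_smul_const F G E x).comp mdifferentiable_fst) fun p => ?_
  have e1 : plainDeriv (𝓘(ℝ, F).prod 𝓘(ℝ, E)) 𝓘(ℝ, E) (fun p : G × M => p.1 • x) p =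
      (plainDeriv 𝓘(ℝ, F) 𝓘(ℝ, E) (fun a : G => a • x) p.1).comp (.fst ℝ F E) :=
    (plainDeriv_comp (mdifferentiable_smul_const F G E x p.1)
      mdifferentiable_fst.mdifferentiableAt).trans (congrArg _ (mfderiv_fst ..))
  refine (DFunLike.congr_fun e1 (skewField (fun _ => ξ) Y p : F × E)).trans ?_
  have h := plainDeriv_orbit_mul_left (E := E) p.1 x ξ
  rw [← hξ, hX.push_eq] at h
  exact h

variable [FiniteDimensional ℝ F] [FiniteDimensional ℝ E] [T2Space M]

omit [MulAction G M] in
/-- Trajectories of `Y` lift to the skew product on `G × M`. -/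
theorem exists_reach_skewField {ψ : M → F} (hψ : ContMDiff 𝓘(ℝ, E) 𝓘(ℝ, F) ∞ ψ)
    (hY : SmoothField Y) (h : Reach Y t m q) :
    ∃ g : G, Reach (skewField ψ Y) t (1, m) (g, q) := by
  have := t2Space_of_lieGroup F G
  have : CompleteSpace E := FiniteDimensional.complete ℝ E
  have : CompleteSpace F := FiniteDimensional.complete ℝ F
  have hW := contMDiff_skewField (G := G) hψ hY
  obtain ⟨γ, rfl, rfl, a, b, h0, ht, hγ⟩ := h
  -- Each piece of the lift starts at `1`; left translation by the end point of the preceding piece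
  -- makes consecutive pieces fit, which proves transitivity.
  have key := isPreconnected_Ioo.induction₂' (s := Ioo a b)
    (fun s s' => ∃ g : G, Reach (skewField ψ Y) (s' - s) (1, γ s) (g, γ s'))
    (fun s₀ hs₀ => by
      obtain ⟨U, hU, ε, hε, Φ, h⟩ := exists_local_flow ((hW.of_le two_le_infty) ((1 : G), γ s₀))
      have hγc : ContinuousWithinAt (fun s => ((1 : G), γ s)) (Ioo a b) s₀ :=
        continuousWithinAt_const.prodMk (hγ.continuousWithinAt hs₀)
      filter_upwards [hγc.preimage_mem_nhdsWithin hU, self_mem_nhdsWithin,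
        mem_nhdsWithin_of_mem_nhds (Ioo_mem_nhds (by linarith : s₀ - ε < s₀)
          (by linarith : s₀ < s₀ + ε))] with s hsU hs hsε
      have key : ∀ s s', s ∈ Ioo a b → s' ∈ Ioo a b → ((1 : G), γ s) ∈ U → s' - s ∈ Ioo (-ε) ε →
          ∃ g : G, Reach (skewField ψ Y) (s' - s) (1, γ s) (g, γ s') := by
        intro s s' hs hs' hsU hss
        have hr := (h _ hsU _ hss).1
        have he : (Φ (s' - s) (1, γ s)).2 = γ s' :=
          hr.snd.eq (hY.of_le (by simp)) (reach_of_isMIntegralCurveOn hγ hs hs')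
        exact ⟨(Φ (s' - s) (1, γ s)).1, he ▸ hr⟩
      exact ⟨key s₀ s hs₀ hs (mem_of_mem_nhds hU) ⟨by linarith [hsε.1], by linarith [hsε.2]⟩,
        key s s₀ hs hs₀ hsU ⟨by linarith [hsε.2], by linarith [hsε.1]⟩⟩)
    (fun s₁ s₂ s₃ _ _ _ h12 h23 => by
      obtain ⟨g, hg⟩ := h12
      obtain ⟨g', hg'⟩ := h23
      have hg'' := hg'.mul_left g
      rw [mul_one] at hg''
      have := hg.trans (hW.of_le (by simp)) hg''
      exact ⟨g * g', by rwa [show s₂ - s₁ + (s₃ - s₂) = s₃ - s₁ by ring] at this⟩) h0 ht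
  simpa using key

variable [ContMDiffSMul 𝓘(ℝ, F) 𝓘(ℝ, E) ∞ G M]

/-- The flows of isomorphic vector fields agree up to the action of the group. -/
theorem Isomorphic.exists_reach (hX : IsInvariantVectorField G X)
    (hY : IsInvariantVectorField G Y) (hXY : Isomorphic F G X Y) (h : Reach Y t m q) :
    ∃ g : G, Reach X t m (g • q) := by
  obtain ⟨ψ, hψ, hψX⟩ := hXY.exists_smooth
  obtain ⟨g, hg⟩ := exists_reach_skewField (G := G) hψ hY.smoothField h
  exact ⟨g, by simpa using hg.smul_of_skewField hX hψX⟩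

/-- The flows of isomorphic vector fields agree up to a map to the group that is differentiable in
the initial point. -/
theorem Isomorphic.exists_flowMap_eq (hX : IsInvariantVectorField G X)
    (hY : IsInvariantVectorField G Y) (hXY : Isomorphic F G X Y) (h : Reach Y t m q) :
    ∃ g : M → G, MDifferentiableAt 𝓘(ℝ, E) 𝓘(ℝ, F) g m ∧
      ∀ᶠ p in 𝓝 m, flowMap X t p = g p • flowMap Y t p := by
  have := t2Space_of_lieGroup F G
  have : CompleteSpace E := FiniteDimensional.complete ℝ E
  have : CompleteSpace F := FiniteDimensional.complete ℝ F
  obtain ⟨ψ, hψ, hψX⟩ := hXY.exists_smooth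
  obtain ⟨g, hg⟩ := exists_reach_skewField (G := G) hψ hY.smoothField h
  have hW := contMDiff_skewField (G := G) hψ hY.smoothField
  obtain ⟨Θ, h1, h2⟩ := hg.exists_mdifferentiableAt (hW.of_le two_le_infty)
  have hi : MDifferentiableAt 𝓘(ℝ, E) (𝓘(ℝ, F).prod 𝓘(ℝ, E)) (fun p : M => ((1 : G), p)) m :=
    mdifferentiableAt_const.prodMk mdifferentiableAt_id
  refine ⟨fun p => (Θ (1, p)).1, ?_, ?_⟩
  · exact (mdifferentiable_fst.mdifferentiableAt (x := Θ (1, m))).comp m (h2.comp m hi)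
  · filter_upwards [hi.continuousAt.eventually h1] with p hp
    have h3 := hp.smul_of_skewField (g' := (Θ (1, p)).1) (q := (Θ (1, p)).2) hX hψX
    rw [one_smul] at h3
    rw [h3.flowMap_eq hX.smoothField, hp.snd.flowMap_eq hY.smoothField]

/-- The linearized flows of isomorphic vector fields agree up to the action of the group and up to
vectors tangent to the orbits. -/
theorem Isomorphic.exists_flowD_eq (hX : IsInvariantVectorField G X)
    (hY : IsInvariantVectorField G Y) (hXY : Isomorphic F G X Y) (h : Reach Y t m q) :
    ∃ g : G, flowMap X t m = g • q ∧
      ∀ v : E, ∃ w ∈ orbitDir F G E (g • q), flowD X t m v = push E g q (flowD Y t m v) + w := by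
  obtain ⟨g, hg, heq⟩ := hXY.exists_flowMap_eq hX hY h
  have hq := h.flowMap_eq hY.smoothField
  obtain ⟨-, hYd⟩ := h.mdifferentiableAt_flowMap hY.smoothField
  refine ⟨g m, by rw [heq.self_of_nhds, hq], fun v => ?_⟩
  -- Product rule for `g p • flowMap Y t p`: the term that differentiates the group factor is
  -- tangent to the orbit.
  refine ⟨_, plainDeriv_orbit_mem (g m) q (plainDeriv 𝓘(ℝ, E) 𝓘(ℝ, F) g m v), ?_⟩
  have hc := plainDeriv_comp (f := fun p => (g p, flowMap Y t p))
    (mdifferentiable_smul F G E M (g m, flowMap Y t m)) (hg.prodMk hYd)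
  rw [plainDeriv_prodMk hg hYd] at hc
  rw [flowD, plainDeriv_congr heq]
  refine (DFunLike.congr_fun hc v).trans ?_
  refine (plainDeriv_smul (g m) (flowMap Y t m) _ _).trans ?_
  rw [hq, add_comm]
  rfl

omit [LieGroup 𝓘(ℝ, F) ∞ G] [FiniteDimensional ℝ F] [FiniteDimensional ℝ E] [T2Space M] in
include F in
variable (F) in
theorem Reach.smul (hX : IsInvariantVectorField G X) (g : G) (h : Reach X t m q) :
    Reach X t (g • m) (g • q) :=
  h.map (mdifferentiable_const_smul F E M g) (hX.invariant g)

omit [LieGroup 𝓘(ℝ, F) ∞ G] [FiniteDimensional ℝ F] [FiniteDimensional ℝ E] in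
include F in
variable (F) in
theorem flowMap_smul (hX : IsInvariantVectorField G X) (g : G) (m : M) :
    flowMap X t (g • m) = g • flowMap X t m := by
  by_cases h : ∃ q, Reach X t m q
  · obtain ⟨q, hq⟩ := h
    rw [hq.flowMap_eq hX.smoothField, (hq.smul F hX g).flowMap_eq hX.smoothField]
  -- Outside the domain the flow map is the identity by convention, and this too is equivariant.
  · rw [flowMap_of_not_reach h, flowMap_of_not_reach]
    rintro ⟨q, hq⟩
    exact h ⟨g⁻¹ • q, by simpa using hq.smul F hX g⁻¹⟩

omit [LieGroup 𝓘(ℝ, F) ∞ G] [FiniteDimensional ℝ F] in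
include F in
variable (F) in
theorem flowD_smul (hX : IsInvariantVectorField G X) (g : G) (h : Reach X t m q) (v : E) :
    flowD X t (g • m) (push E g m v) = push E g q (flowD X t m v) := by
  have h1 := plainDeriv_comp
    ((h.smul F hX g).mdifferentiableAt_flowMap hX.smoothField).2
    (mdifferentiable_const_smul F E M g m)
  have h2 := plainDeriv_comp (mdifferentiable_const_smul F E M g (flowMap X t m))
    (h.mdifferentiableAt_flowMap hX.smoothField).2
  simp only [flowMap_smul F hX] at h1
  rw [h1, h.flowMap_eq hX.smoothField] at h2
  exact DFunLike.congr_fun h2 v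

-- Differentiate `Φ_t(a • m) = a • Φ_t(m)` in `a` at `1`: the linearized flow preserves
-- infinitesimal generators. This controls its growth along orbit directions.
omit [LieGroup 𝓘(ℝ, F) ∞ G] [FiniteDimensional ℝ F] in
theorem flowD_infAct (hX : IsInvariantVectorField G X) (h : Reach X t m q) (ζ : F) :
    flowD X t m (infAct F G E m ζ) = infAct F G E q ζ := by
  have h' := h
  rw [← one_smul G m] at h'
  have h1 := plainDeriv_comp (x := (1 : G)) (h'.mdifferentiableAt_flowMap hX.smoothField).2
    (mdifferentiable_smul_const F G E m 1)
  simp only [flowMap_smul F hX, one_smul, h.flowMap_eq hX.smoothField] at h1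
  exact (DFunLike.congr_fun h1 ζ).symm

/-- On a relative equilibrium the flow is given by a one-parameter subgroup. -/
theorem exists_oneParam {x : M} (hX : IsInvariantVectorField G X)
    (hx : IsRelativeEquilibrium F G X x) :
    ∃ f : ℝ → G, (∀ s t, f (s + t) = f s * f t) ∧ ∀ t, Reach X t x (f t • x) := by
  have := t2Space_of_lieGroup F G
  have : CompleteSpace E := FiniteDimensional.complete ℝ E
  have : CompleteSpace F := FiniteDimensional.complete ℝ F
  obtain ⟨ξ, hξ⟩ : ∃ ξ : F, infAct F G E x ξ = fieldVec X x := hx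
  have h0 : SmoothField (fun m : M => (0 : TangentSpace 𝓘(ℝ, E) m)) :=
    Bundle.contMDiff_zeroSection ℝ (TangentSpace 𝓘(ℝ, E) : M → Type _)
  -- The zero field rests at `x` for all time, so its lifts with constant `ξ` are trajectories of
  -- the left invariant field of `ξ` for all time: `f t` is `exp(tξ)`.
  have hr : ∀ t, Reach (fun m : M => (0 : TangentSpace 𝓘(ℝ, E) m)) t x x := fun t =>
    ⟨fun _ => x, rfl, rfl, min 0 t - 1, max 0 t + 1,
      ⟨by linarith [min_le_left 0 t], by linarith [le_max_left 0 t]⟩,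
      ⟨by linarith [min_le_right 0 t], by linarith [le_max_right 0 t]⟩,
      (isMIntegralCurve_const rfl).isMIntegralCurveOn _⟩
  have hW := contMDiff_skewField (G := G) (contMDiff_const (c := ξ)) h0
  choose f hf using fun t => exists_reach_skewField (G := G) (contMDiff_const (c := ξ)) h0 (hr t)
  refine ⟨f, fun s t => ?_, fun t => by simpa using (hf t).smul_of_const hX hξ.symm⟩
  have h1 := (hf t).mul_left (f s)
  rw [mul_one] at h1
  exact congrArg Prod.fst ((hf (s + t)).eq (hW.of_le (by simp))
    ((hf s).trans (hW.of_le (by simp)) h1))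

end Action

/-! ### Uniform bounds for homogeneous functions over a compact parameter space. -/

section Homogeneous

variable {K : Type*} [TopologicalSpace K] [CompactSpace K]
  {V : Type*} [NormedAddCommGroup V] [NormedSpace ℝ V] [FiniteDimensional ℝ V]

/-- A continuous family of positively homogeneous functions, indexed by a compact space, is
bounded by a multiple of the norm. -/
theorem exists_forall_le_mul_norm {Q : K → V → ℝ} (hQ : Continuous fun p : K × V => Q p.1 p.2)
    (hs : ∀ k v (c : ℝ), Q k (c • v) = |c| * Q k v) : ∃ C > 0, ∀ k v, Q k v ≤ C * ‖v‖ := by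
  have hcpt : IsCompact (univ ×ˢ sphere (0 : V) 1 : Set (K × V)) :=
    isCompact_univ.prod (isCompact_sphere 0 1)
  obtain ⟨C, hC⟩ := hcpt.bddAbove_image hQ.continuousOn
  refine ⟨max C 1, by positivity, fun k v => ?_⟩
  rcases eq_or_ne v 0 with rfl | hv
  · have := hs k 0 0
    simp only [zero_smul, abs_zero, zero_mul] at this
    simp [this]
  have hv' : 0 < ‖v‖ := norm_pos_iff.2 hv
  have h1 : Q k (‖v‖⁻¹ • v) ≤ C := hC ⟨(k, ‖v‖⁻¹ • v), ⟨mem_univ _, by simp [norm_smul, hv]⟩, rfl⟩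
  have h2 : Q k v = ‖v‖ * Q k (‖v‖⁻¹ • v) := by
    have := hs k (‖v‖⁻¹ • v) ‖v‖
    rwa [smul_inv_smul₀ hv'.ne', abs_of_pos hv'] at this
  rw [h2, mul_comm]
  gcongr
  exact h1.trans (le_max_left _ _)

/-- A continuous family of positive and positively homogeneous functions, indexed by a compact
space, is bounded below by a multiple of the norm. -/
theorem exists_forall_mul_norm_le {Q : K → V → ℝ} (hQ : Continuous fun p : K × V => Q p.1 p.2)
    (hs : ∀ k v (c : ℝ), Q k (c • v) = |c| * Q k v) (hpos : ∀ k, ∀ v ≠ 0, 0 < Q k v) :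
    ∃ c > 0, ∀ k v, c * ‖v‖ ≤ Q k v := by
  have hcpt : IsCompact (univ ×ˢ sphere (0 : V) 1 : Set (K × V)) :=
    isCompact_univ.prod (isCompact_sphere 0 1)
  have hne : ∀ v ∈ sphere (0 : V) 1, v ≠ 0 := fun v hv h => by simp [h] at hv
  have hunit : ∃ c > 0, ∀ k, ∀ v ∈ sphere (0 : V) 1, c ≤ Q k v := by
    -- The product is empty when `V` is trivial or `K` is empty; then there is no minimum to take
    -- and any constant serves.
    rcases (univ ×ˢ sphere (0 : V) 1 : Set (K × V)).eq_empty_or_nonempty with h | h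
    · refine ⟨1, one_pos, fun k v hv => ?_⟩
      have : (k, v) ∈ (univ ×ˢ sphere (0 : V) 1 : Set (K × V)) := ⟨mem_univ _, hv⟩
      rw [h] at this
      exact this.elim
    · obtain ⟨p, hp, hmin⟩ := hcpt.exists_isMinOn h hQ.continuousOn
      exact ⟨Q p.1 p.2, hpos _ _ (hne _ hp.2), fun k v hv => hmin (a := (k, v)) ⟨mem_univ _, hv⟩⟩
  obtain ⟨c, hc, hle⟩ := hunit
  refine ⟨c, hc, fun k v => ?_⟩
  rcases eq_or_ne v 0 with rfl | hv
  · have := hs k 0 0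
    simp only [zero_smul, abs_zero, zero_mul] at this
    simp [this]
  have hv' : 0 < ‖v‖ := norm_pos_iff.2 hv
  have h1 : c ≤ Q k (‖v‖⁻¹ • v) := hle k _ (by simp [norm_smul, hv])
  have h2 : Q k v = ‖v‖ * Q k (‖v‖⁻¹ • v) := by
    have := hs k (‖v‖⁻¹ • v) ‖v‖
    rwa [smul_inv_smul₀ hv'.ne', abs_of_pos hv'] at this
  rw [h2, mul_comm]
  gcongr

end Homogeneous

/-! ### The norm defined by a Riemannian metric. -/

section Length

variable {E : Type*} [NormedAddCommGroup E] [NormedSpace ℝ E]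
  {M : Type*} [TopologicalSpace M] [ChartedSpace E M] [IsManifold 𝓘(ℝ, E) ∞ M]
  (μ : Metric E M)

/-- A Riemannian metric at a point, as a bilinear form on the model space. -/
noncomputable def Metric.form (m : M) : E →L[ℝ] E →L[ℝ] ℝ := μ.inner m

/-- The length of a tangent vector, as a function on the model space. -/
noncomputable def Metric.len (m : M) (v : E) : ℝ := μ.length m v

theorem Metric.len_eq (m : M) (v : E) : μ.len m v = √(μ.form m v v) := rfl

theorem Metric.form_symm (m : M) (v w : E) : μ.form m v w = μ.form m w v := μ.symm m v w

theorem Metric.form_pos (m : M) {v : E} (hv : v ≠ 0) : 0 < μ.form m v v := μ.pos m v hv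

theorem Metric.form_nonneg (m : M) (v : E) : 0 ≤ μ.form m v v := by
  rcases eq_or_ne v 0 with rfl | hv
  · simp
  · exact (μ.form_pos m hv).le

theorem Metric.len_nonneg (m : M) (v : E) : 0 ≤ μ.len m v := Real.sqrt_nonneg _

theorem Metric.len_pos (m : M) {v : E} (hv : v ≠ 0) : 0 < μ.len m v :=
  Real.sqrt_pos.2 (μ.form_pos m hv)

theorem Metric.len_smul (m : M) (v : E) (c : ℝ) : μ.len m (c • v) = |c| * μ.len m v := by
  rw [μ.len_eq, μ.len_eq, map_smul, map_smul, smul_apply, smul_eq_mul,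
    smul_eq_mul, ← mul_assoc, Real.sqrt_mul (mul_self_nonneg c), Real.sqrt_mul_self_eq_abs]

theorem Metric.len_neg (m : M) (v : E) : μ.len m (-v) = μ.len m v := by
  rw [← neg_one_smul ℝ, μ.len_smul]; simp

theorem Metric.form_sq_le (m : M) (v w : E) :
    (μ.form m v w) ^ 2 ≤ μ.form m v v * μ.form m w w := by
  let B : LinearMap.BilinForm ℝ E := (ContinuousLinearMap.coeLM ℝ).comp (μ.form m).toLinearMap
  exact LinearMap.BilinForm.apply_sq_le_of_symm B (μ.form_nonneg m) ⟨μ.form_symm m⟩ v w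

theorem Metric.len_add_le (m : M) (v w : E) : μ.len m (v + w) ≤ μ.len m v + μ.len m w := by
  have h0 := add_nonneg (μ.len_nonneg m v) (μ.len_nonneg m w)
  have hv : μ.len m v ^ 2 = μ.form m v v := Real.sq_sqrt (μ.form_nonneg m v)
  have hw : μ.len m w ^ 2 = μ.form m w w := Real.sq_sqrt (μ.form_nonneg m w)
  have hvw : μ.form m v w ≤ μ.len m v * μ.len m w := by
    refine le_of_sq_le_sq ?_ (mul_nonneg (μ.len_nonneg m v) (μ.len_nonneg m w))
    rw [mul_pow, hv, hw]
    exact μ.form_sq_le m v w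
  rw [μ.len_eq m (v + w), Real.sqrt_le_left h0]
  simp only [map_add, add_apply]
  rw [μ.form_symm m w v]
  nlinarith

theorem Metric.len_sub_le (m : M) (v w : E) : μ.len m (v - w) ≤ μ.len m v + μ.len m w := by
  simpa [sub_eq_add_neg, μ.len_neg] using μ.len_add_le m v (-w)

/-- The length depends continuously on the tangent vector. -/
theorem Metric.continuous_len {K : Type*} [TopologicalSpace K] {b : K → M} {v : K → E}
    (hv : Continuous fun k => (⟨b k, v k⟩ : TangentBundle 𝓘(ℝ, E) M)) :
    Continuous fun k => μ.len (b k) (v k) := by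
  refine Real.continuous_sqrt.comp ?_
  have hb : Continuous b := (FiberBundle.continuous_proj E (TangentSpace 𝓘(ℝ, E))).comp hv
  have hg : Continuous fun k => Bundle.TotalSpace.mk' (E →L[ℝ] E →L[ℝ] ℝ)
      (E := fun m : M => TangentSpace 𝓘(ℝ, E) m →L[ℝ] TangentSpace 𝓘(ℝ, E) m →L[ℝ] ℝ)
      (b k) (μ.inner (b k)) := μ.contMDiff.continuous.comp hb
  rw [continuous_iff_continuousAt]
  intro k
  have : ContinuousWithinAt (fun k => Bundle.TotalSpace.mk' ℝ (E := Bundle.Trivial M ℝ) (b k)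
      (μ.inner (b k) (v k) (v k))) univ k :=
    hg.continuousAt.continuousWithinAt.clm_bundle_apply₂ (F₁ := E) (F₂ := E)
      hv.continuousAt.continuousWithinAt hv.continuousAt.continuousWithinAt
  rw [continuousWithinAt_univ, FiberBundle.continuousAt_totalSpace] at this
  exact this.2

variable [FiniteDimensional ℝ E]

theorem Metric.exists_mul_norm_le_len (m : M) : ∃ c > 0, ∀ v, c * ‖v‖ ≤ μ.len m v := by
  obtain ⟨c, hc, h⟩ := exists_forall_mul_norm_le (K := Unit) (Q := fun _ v => μ.len m v)
    (by simp only [μ.len_eq]; fun_prop) (fun _ => μ.len_smul m) (fun _ v => μ.len_pos m)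
  exact ⟨c, hc, h ()⟩

end Length

/-! ### The quotient norm on the normal spaces. -/

section NormalLength

variable {F : Type*} [NormedAddCommGroup F] [NormedSpace ℝ F]
  {G : Type*} [TopologicalSpace G] [ChartedSpace F G] [Group G]
  {E : Type*} [NormedAddCommGroup E] [NormedSpace ℝ E]
  {M : Type*} [TopologicalSpace M] [ChartedSpace E M] [IsManifold 𝓘(ℝ, E) ∞ M] [MulAction G M]
  {μ : Metric E M}

variable (F G μ) in
/-- The quotient norm on the normal space to an orbit, as a function on the model space. -/
noncomputable def nlen (m : M) (v : E) : ℝ := normalLength F G μ m v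

theorem nlen_nonneg (m : M) (v : E) : 0 ≤ nlen F G μ m v :=
  Real.iInf_nonneg fun _ => μ.len_nonneg _ _

theorem nlen_le {m : M} (v : E) {w : E} (hw : w ∈ orbitDir F G E m) :
    nlen F G μ m v ≤ μ.len m (v - w) :=
  ciInf_le ⟨0, by rintro _ ⟨w, rfl⟩; exact μ.len_nonneg _ _⟩ (⟨w, hw⟩ : orbitDir F G E m)

theorem le_nlen {m : M} {v : E} {c : ℝ} (h : ∀ w ∈ orbitDir F G E m, c ≤ μ.len m (v - w)) :
    c ≤ nlen F G μ m v :=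
  le_ciInf fun w => h w.1 w.2

theorem exists_lt_of_nlen_lt {m : M} {v : E} {c : ℝ} (h : nlen F G μ m v < c) :
    ∃ w ∈ orbitDir F G E m, μ.len m (v - w) < c := by
  obtain ⟨w, hw⟩ := exists_lt_of_ciInf_lt h
  exact ⟨w.1, w.2, hw⟩

theorem nlen_add_le (m : M) (v v' : E) :
    nlen F G μ m (v + v') ≤ nlen F G μ m v + nlen F G μ m v' := by
  refine le_of_forall_pos_le_add fun ε hε => ?_
  obtain ⟨w, hw, h⟩ := exists_lt_of_nlen_lt (lt_add_of_pos_right (nlen F G μ m v) (half_pos hε))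
  obtain ⟨w', hw', h'⟩ := exists_lt_of_nlen_lt
    (lt_add_of_pos_right (nlen F G μ m v') (half_pos hε))
  have h1 := nlen_le (μ := μ) (v + v') (add_mem hw hw')
  have h2 := μ.len_add_le m (v - w) (v' - w')
  rw [show v - w + (v' - w') = v + v' - (w + w') by abel] at h2
  linarith

theorem nlen_neg (m : M) (v : E) : nlen F G μ m (-v) = nlen F G μ m v := by
  have key : ∀ v : E, nlen F G μ m (-v) ≤ nlen F G μ m v := fun v => le_nlen fun w hw => by
    have := nlen_le (μ := μ) (-v) (neg_mem hw)
    rwa [← neg_sub', μ.len_neg] at this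
  refine le_antisymm (key v) ?_
  simpa using key (-v)

theorem nlen_add_mem (m : M) (v : E) {w : E} (hw : w ∈ orbitDir F G E m) :
    nlen F G μ m (v + w) = nlen F G μ m v := by
  have key : ∀ v w : E, w ∈ orbitDir F G E m → nlen F G μ m (v + w) ≤ nlen F G μ m v :=
    fun v w hw => le_nlen fun u hu => by
      have := nlen_le (μ := μ) (v + w) (add_mem hu hw)
      rwa [add_sub_add_right_eq_sub] at this
  refine le_antisymm (key v w hw) ?_
  simpa using key (v + w) (-w) (neg_mem hw)

/-- An infimum equal to zero puts `v` in the closure of the orbit directions, and a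
finite-dimensional subspace is closed. -/
theorem mem_orbitDir_of_nlen_eq_zero [FiniteDimensional ℝ E] {m : M} {v : E}
    (h : nlen F G μ m v = 0) : v ∈ orbitDir F G E m := by
  have hcl : IsClosed (orbitDir F G E m : Set E) := (orbitDir F G E m).closed_of_finiteDimensional
  obtain ⟨c, hc, hle⟩ := μ.exists_mul_norm_le_len m
  refine hcl.closure_subset (Metric.mem_closure_iff.2 fun ε hε => ?_)
  obtain ⟨w, hw, hlt⟩ := exists_lt_of_nlen_lt (h.trans_lt (mul_pos hc hε))
  refine ⟨w, hw, ?_⟩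
  rw [dist_eq_norm]
  exact lt_of_mul_lt_mul_left ((hle _).trans_lt hlt) hc.le

omit [TopologicalSpace G] [ChartedSpace F G] in
theorem Metric.IsInvariant.len_push (hμ : μ.IsInvariant G) (g : G) (m : M) (v : E) :
    μ.len (g • m) (push E g m v) = μ.len m v :=
  congrArg Real.sqrt (hμ g m v v)

theorem Metric.IsInvariant.nlen_push [LieGroup 𝓘(ℝ, F) ∞ G]
    [ContMDiffSMul 𝓘(ℝ, F) 𝓘(ℝ, E) ∞ G M] (hμ : μ.IsInvariant G) (g : G) (m : M) (v : E) :
    nlen F G μ (g • m) (push E g m v) = nlen F G μ m v := by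
  have key : ∀ (g : G) (m : M) (v : E),
      nlen F G μ (g • m) (push E g m v) ≤ nlen F G μ m v := fun g m v => le_nlen fun w hw => by
    have := nlen_le (μ := μ) (push E g m v) (push_mem_orbitDir g hw)
    rwa [← map_sub, hμ.len_push] at this
  refine le_antisymm (key g m v) ?_
  have := key g⁻¹ (g • m) (push E g m v)
  rwa [push_inv_push F, inv_smul_smul] at this

end NormalLength

/-! ### The flow on the orbit space, relative equilibria and relative periodic orbits. -/

section OrbitSpace

variable {F : Type*} [NormedAddCommGroup F] [NormedSpace ℝ F] [FiniteDimensional ℝ F]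
  {G : Type*} [TopologicalSpace G] [ChartedSpace F G] [Group G] [LieGroup 𝓘(ℝ, F) ∞ G]
  {E : Type*} [NormedAddCommGroup E] [NormedSpace ℝ E] [FiniteDimensional ℝ E]
  {M : Type*} [TopologicalSpace M] [T2Space M] [ChartedSpace E M] [IsManifold 𝓘(ℝ, E) ∞ M]
  [MulAction G M] [ContMDiffSMul 𝓘(ℝ, F) 𝓘(ℝ, E) ∞ G M]
  {X Y : (m : M) → TangentSpace 𝓘(ℝ, E) m}

theorem mem_map_flow_iff (hX : IsInvariantVectorField G X) {t : ℝ} {m : M}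
    {b : MulAction.orbitRel.Quotient G M} :
    b ∈ (flow X t m).map (Quotient.mk (MulAction.orbitRel G M)) ↔
      ∃ q, Reach X t m q ∧ Quotient.mk (MulAction.orbitRel G M) q = b := by
  simp only [Part.mem_map_iff, mem_flow_iff hX.smoothField]

theorem quotient_mk_smul (g : G) (m : M) :
    Quotient.mk (MulAction.orbitRel G M) (g • m) = Quotient.mk (MulAction.orbitRel G M) m :=
  Quotient.sound ⟨g, rfl⟩

/-- The local flow of an invariant vector field on the orbit space. -/
noncomputable def orbitFlow (F : Type*) [NormedAddCommGroup F] [NormedSpace ℝ F]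
    [FiniteDimensional ℝ F] [ChartedSpace F G] [LieGroup 𝓘(ℝ, F) ∞ G]
    [ContMDiffSMul 𝓘(ℝ, F) 𝓘(ℝ, E) ∞ G M] (hX : IsInvariantVectorField G X) (t : ℝ) :
    MulAction.orbitRel.Quotient G M →. MulAction.orbitRel.Quotient G M :=
  Quotient.lift (fun m => (flow X t m).map (Quotient.mk (MulAction.orbitRel G M))) (by
    rintro _ m ⟨g, rfl⟩
    refine Part.ext fun b => ?_
    simp only [mem_map_flow_iff hX]
    constructor
    · rintro ⟨q, hq, rfl⟩
      exact ⟨g⁻¹ • q, by simpa using hq.smul F hX g⁻¹, quotient_mk_smul _ _⟩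
    · rintro ⟨q, hq, rfl⟩
      exact ⟨g • q, hq.smul F hX g, quotient_mk_smul _ _⟩)

theorem Isomorphic.map_flow_eq (hX : IsInvariantVectorField G X) (hY : IsInvariantVectorField G Y)
    (hXY : Isomorphic F G X Y) (t : ℝ) (m : M) :
    (flow X t m).map (Quotient.mk (MulAction.orbitRel G M)) =
      (flow Y t m).map (Quotient.mk (MulAction.orbitRel G M)) := by
  refine Part.ext fun b => ?_
  simp only [mem_map_flow_iff hX, mem_map_flow_iff hY]
  constructor
  · rintro ⟨q, hq, rfl⟩
    obtain ⟨g, hg⟩ := hXY.symm.exists_reach hY hX hq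
    exact ⟨_, hg, quotient_mk_smul _ _⟩
  · rintro ⟨q, hq, rfl⟩
    obtain ⟨g, hg⟩ := hXY.exists_reach hX hY hq
    exact ⟨_, hg, quotient_mk_smul _ _⟩

theorem Isomorphic.exists_inducesOnOrbitSpace (hX : IsInvariantVectorField G X)
    (hY : IsInvariantVectorField G Y) (hXY : Isomorphic F G X Y) :
    ∃ Ψ : ℝ → MulAction.orbitRel.Quotient G M →. MulAction.orbitRel.Quotient G M,
      InducesOnOrbitSpace G X Ψ ∧ InducesOnOrbitSpace G Y Ψ :=
  ⟨orbitFlow F hX, fun _ _ => rfl, fun t m => hXY.map_flow_eq hX hY t m⟩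

omit [FiniteDimensional ℝ F] [LieGroup 𝓘(ℝ, F) ∞ G] [FiniteDimensional ℝ E] [T2Space M]
  [IsManifold 𝓘(ℝ, E) ∞ M] [ContMDiffSMul 𝓘(ℝ, F) 𝓘(ℝ, E) ∞ G M] in
theorem Isomorphic.isRelativeEquilibrium (hXY : Isomorphic F G X Y) {x : M}
    (hx : IsRelativeEquilibrium F G Y x) : IsRelativeEquilibrium F G X x := by
  obtain ⟨ψ, -, h⟩ := hXY
  rw [IsRelativeEquilibrium, h]
  exact add_mem hx ⟨ψ x, rfl⟩

/-- At each time the trajectories of `X` and `Y` from `x` lie on the same `G`-orbit, so the return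
time and the union of orbits carry over unchanged. -/
theorem Isomorphic.isRelativePeriodicOrbit (hX : IsInvariantVectorField G X)
    (hY : IsInvariantVectorField G Y) (hXY : Isomorphic F G X Y) {P : Set M}
    (hP : IsRelativePeriodicOrbit F G Y P) : IsRelativePeriodicOrbit F G X P := by
  have key : ∀ {X Y : (m : M) → TangentSpace 𝓘(ℝ, E) m}, IsInvariantVectorField G X →
      IsInvariantVectorField G Y → Isomorphic F G X Y → ∀ {x z : M} {t : ℝ},
      (∃ y ∈ flow Y t x, z ∈ MulAction.orbit G y) → ∃ y ∈ flow X t x, z ∈ MulAction.orbit G y := by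
    rintro X Y hX hY hXY x _ t ⟨y, hy, g, rfl⟩
    rw [mem_flow_iff hY.smoothField] at hy
    obtain ⟨h, hh⟩ := hXY.exists_reach hX hY hy
    refine ⟨h • y, (mem_flow_iff hX.smoothField).2 hh, g * h⁻¹, ?_⟩
    simp [mul_smul]
  obtain ⟨x, hx, ⟨T, hT, y, hy, hyx⟩, rfl⟩ := hP
  refine ⟨x, fun h => hx (hXY.symm.isRelativeEquilibrium h), ⟨T, hT, ?_⟩, ?_⟩
  · obtain ⟨y', hy', hxy'⟩ := key hX hY hXY (t := T) (x := x) (z := x)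
      ⟨y, hy, MulAction.mem_orbit_symm.1 hyx⟩
    exact ⟨y', hy', MulAction.mem_orbit_symm.1 hxy'⟩
  · ext z
    exact exists_congr fun t => ⟨key hX hY hXY, key hY hX hXY.symm⟩

end OrbitSpace

theorem tendsto_const_mul_exp_neg {a : ℝ} (ha : 0 < a) (c : ℝ) :
    Tendsto (fun t : ℝ => c * Real.exp (-a * t)) atTop (𝓝 0) := by
  have h : Tendsto (fun t : ℝ => -a * t) atTop atBot :=
    tendsto_id.const_mul_atTop_of_neg (by linarith)
  simpa using (Real.tendsto_exp_atBot.comp h).const_mul c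

/-! ### Hyperbolic relative equilibria. -/

section Hyperbolic

variable {F : Type*} [NormedAddCommGroup F] [NormedSpace ℝ F] [FiniteDimensional ℝ F]
  {G : Type*} [TopologicalSpace G] [ChartedSpace F G] [Group G] [LieGroup 𝓘(ℝ, F) ∞ G]
  {E : Type*} [NormedAddCommGroup E] [NormedSpace ℝ E] [FiniteDimensional ℝ E]
  {M : Type*} [TopologicalSpace M] [T2Space M] [ChartedSpace E M] [IsManifold 𝓘(ℝ, E) ∞ M]
  [MulAction G M] [ContMDiffSMul 𝓘(ℝ, F) 𝓘(ℝ, E) ∞ G M]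
  {X Y : (m : M) → TangentSpace 𝓘(ℝ, E) m} {μ : Metric E M} {x : M}

theorem IsRelativeEquilibrium.smul (hX : IsInvariantVectorField G X)
    (hx : IsRelativeEquilibrium F G X x) (g : G) : IsRelativeEquilibrium F G X (g • x) := by
  have := push_mem_orbitDir (F := F) (v := fieldVec X x) g hx
  rwa [hX.push_eq] at this

/-- The flow on the orbit of a relative equilibrium is complete and preserves the orbit. -/
theorem IsRelativeEquilibrium.reach (hX : IsInvariantVectorField G X)
    (hx : IsRelativeEquilibrium F G X x) {y : M} (hy : y ∈ MulAction.orbit G x) (t : ℝ) :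
    Reach X t y (flowMap X t y) ∧ flowMap X t y ∈ MulAction.orbit G x := by
  obtain ⟨h, rfl⟩ := hy
  obtain ⟨f, -, hf⟩ := exists_oneParam hX (hx.smul hX h)
  have := (hf t).flowMap_eq hX.smoothField
  rw [this]
  exact ⟨hf t, f t * h, mul_smul _ _ _⟩

/-- An invariant splitting of the normal bundle of an orbit is characterized by the rates of
contraction, if both summands are contracted in opposite directions of time. -/
theorem mem_iff_tendsto_nlen (hX : IsInvariantVectorField G X)
    (hx : IsRelativeEquilibrium F G X x) {P Q : M → Submodule ℝ E} {C a : ℝ} (σ : ℝ) (ha : 0 < a)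
    (hT : ∀ y, orbitDir F G E y ≤ P y)
    (hPQ : ∀ y ∈ MulAction.orbit G x, P y ⊔ Q y = ⊤)
    (hQ : ∀ y ∈ MulAction.orbit G x, ∀ t, ∀ v ∈ Q y, flowD X t y v ∈ Q (flowMap X t y))
    (hPc : ∀ y ∈ MulAction.orbit G x, ∀ t, 0 ≤ t → ∀ v ∈ P y,
      nlen F G μ (flowMap X (σ * t) y) (flowD X (σ * t) y v) ≤
        C * Real.exp (-a * t) * nlen F G μ y v)
    (hQc : ∀ y ∈ MulAction.orbit G x, ∀ t, 0 ≤ t → ∀ v ∈ Q y,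
      nlen F G μ (flowMap X (-(σ * t)) y) (flowD X (-(σ * t)) y v) ≤
        C * Real.exp (-a * t) * nlen F G μ y v)
    {y : M} (hy : y ∈ MulAction.orbit G x) {v : E} :
    v ∈ P y ↔ Tendsto (fun t => nlen F G μ (flowMap X (σ * t) y) (flowD X (σ * t) y v)) atTop
      (𝓝 0) := by
  have hP : ∀ v ∈ P y, Tendsto
      (fun t => nlen F G μ (flowMap X (σ * t) y) (flowD X (σ * t) y v)) atTop (𝓝 0) := by
    intro v hv
    refine squeeze_zero' (Eventually.of_forall fun t => nlen_nonneg _ _)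
      ((eventually_ge_atTop 0).mono fun t ht => hPc y hy t ht v hv) ?_
    simpa using (tendsto_const_mul_exp_neg ha C).mul_const (nlen F G μ y v)
  refine ⟨hP v, fun h => ?_⟩
  -- If `p + q` decays then so does `q`. But contraction of `Q` in the opposite time direction
  -- forbids decay unless `q` has normal length `0`, that is, `q` is an orbit direction and lies in
  -- `P`.
  obtain ⟨p, hp, q, hq, rfl⟩ := Submodule.mem_sup.1 ((hPQ y hy).symm ▸ Submodule.mem_top : v ∈ _)
  refine add_mem hp (hT y (mem_orbitDir_of_nlen_eq_zero (μ := μ) ?_))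
  have hq0 : Tendsto (fun t => nlen F G μ (flowMap X (σ * t) y) (flowD X (σ * t) y q)) atTop
      (𝓝 0) := by
    have hs := h.add (hP p hp)
    rw [add_zero] at hs
    refine squeeze_zero (fun t => nlen_nonneg _ _) (fun t => ?_) hs
    have h1 := nlen_add_le (F := F) (G := G) (μ := μ) (flowMap X (σ * t) y)
      (flowD X (σ * t) y (p + q)) (-flowD X (σ * t) y p)
    rw [map_add, add_neg_cancel_comm, nlen_neg, ← map_add] at h1
    exact h1
  have hb : ∀ᶠ t in atTop, nlen F G μ y q ≤ C * Real.exp (-a * t) *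
      nlen F G μ (flowMap X (σ * t) y) (flowD X (σ * t) y q) := by
    filter_upwards [eventually_ge_atTop 0] with t ht
    obtain ⟨hr, hm⟩ := hx.reach hX hy (σ * t)
    have h1 := hQc _ hm t ht _ (hQ y hy _ q hq)
    have h2 := flowD_add hX.smoothField hr hr.symm q
    rw [hr.symm.flowMap_eq hX.smoothField, ← h2, add_neg_cancel, flowD_zero hX.smoothField] at h1
    exact h1
  have hl := (tendsto_const_mul_exp_neg ha C).mul hq0
  rw [mul_zero] at hl
  exact le_antisymm (ge_of_tendsto hl hb) (nlen_nonneg _ _)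

/-- The decay condition involves only `G`-invariant data, so a subbundle that it characterizes is
`G`-invariant. -/
theorem mem_push_iff_of_mem_iff_tendsto (hX : IsInvariantVectorField G X)
    (hx : IsRelativeEquilibrium F G X x) (hμ : μ.IsInvariant G) {P : M → Submodule ℝ E} {σ : ℝ}
    (h : ∀ y ∈ MulAction.orbit G x, ∀ v, v ∈ P y ↔ Tendsto
      (fun t => nlen F G μ (flowMap X (σ * t) y) (flowD X (σ * t) y v)) atTop (𝓝 0))
    {y : M} (hy : y ∈ MulAction.orbit G x) (g : G) {v : E} :
    push E g y v ∈ P (g • y) ↔ v ∈ P y := by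
  have hg : g • y ∈ MulAction.orbit G x := by
    obtain ⟨k, rfl⟩ := hy
    exact ⟨g * k, mul_smul _ _ _⟩
  rw [h _ hg, h y hy]
  have heq : (fun t => nlen F G μ (flowMap X (σ * t) (g • y))
      (flowD X (σ * t) (g • y) (push E g y v))) =
      fun t => nlen F G μ (flowMap X (σ * t) y) (flowD X (σ * t) y v) := by
    funext t
    rw [flowMap_smul F hX, flowD_smul F hX g (hx.reach hX hy (σ * t)).1, hμ.nlen_push]
  rw [heq]

/-- The metric, the splitting and the constants of `X` all serve for `Y`. -/
theorem Isomorphic.isHyperbolicRelativeEquilibrium (hX : IsInvariantVectorField G X)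
    (hY : IsInvariantVectorField G Y) (hXY : Isomorphic F G X Y)
    (h : IsHyperbolicRelativeEquilibrium F G X x) : IsHyperbolicRelativeEquilibrium F G Y x := by
  obtain ⟨hx, μ, Ns, Nu, C, a, hμ, hC, ha, H⟩ := h
  have hxY : IsRelativeEquilibrium F G Y x := hXY.symm.isRelativeEquilibrium hx
  -- Preimages of the summands in the full tangent spaces; they contain the orbit directions, so
  -- errors tangent to the orbit can be ignored.
  let P : M → Submodule ℝ E := fun y => (Ns y).comap (orbitTangent F G E y).mkQ
  let Q : M → Submodule ℝ E := fun y => (Nu y).comap (orbitTangent F G E y).mkQ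
  have hTP : ∀ y, orbitDir F G E y ≤ P y := fun y v hv => by
    have h0 : (orbitTangent F G E y).mkQ v = 0 := (Submodule.Quotient.mk_eq_zero _).2 hv
    change (orbitTangent F G E y).mkQ v ∈ Ns y
    rw [h0]
    exact zero_mem _
  have hTQ : ∀ y, orbitDir F G E y ≤ Q y := fun y v hv => by
    have h0 : (orbitTangent F G E y).mkQ v = 0 := (Submodule.Quotient.mk_eq_zero _).2 hv
    change (orbitTangent F G E y).mkQ v ∈ Nu y
    rw [h0]
    exact zero_mem _
  have hsup : ∀ y ∈ MulAction.orbit G x, P y ⊔ Q y = ⊤ := fun y hy => by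
    refine eq_top_iff.2 fun v _ => ?_
    obtain ⟨p, hp, q, hq, hpq⟩ := Submodule.mem_sup.1
      ((H y hy).1.sup_eq_top.symm ▸ Submodule.mem_top : (orbitTangent F G E y).mkQ v ∈ _)
    obtain ⟨p, rfl⟩ : ∃ v : E, (orbitTangent F G E y).mkQ v = p := Submodule.mkQ_surjective _ p
    obtain ⟨q, rfl⟩ : ∃ v : E, (orbitTangent F G E y).mkQ v = q := Submodule.mkQ_surjective _ q
    have hw : p + q - v ∈ orbitDir F G E y :=
      (Submodule.Quotient.mk_eq_zero (orbitTangent F G E y)).1 (sub_eq_zero.2 hpq)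
    have hv : v = (p - (p + q - v)) + q := by abel
    rw [hv]
    exact Submodule.add_mem_sup (sub_mem (H := P y) hp (hTP y hw)) hq
  have hPi : ∀ y ∈ MulAction.orbit G x, ∀ t, ∀ v ∈ P y, flowD X t y v ∈ P (flowMap X t y) :=
    fun y hy => (H y hy).2.1
  have hQi : ∀ y ∈ MulAction.orbit G x, ∀ t, ∀ v ∈ Q y, flowD X t y v ∈ Q (flowMap X t y) :=
    fun y hy => (H y hy).2.2.1
  have hPc : ∀ y ∈ MulAction.orbit G x, ∀ t, 0 ≤ t → ∀ v ∈ P y,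
      nlen F G μ (flowMap X t y) (flowD X t y v) ≤ C * Real.exp (-a * t) * nlen F G μ y v :=
    fun y hy t ht v hv => (H y hy).2.2.2.1 t v ht hv
  have hQc : ∀ y ∈ MulAction.orbit G x, ∀ t, 0 ≤ t → ∀ v ∈ Q y,
      nlen F G μ (flowMap X (-t) y) (flowD X (-t) y v) ≤ C * Real.exp (-a * t) * nlen F G μ y v :=
    fun y hy t ht v hv => (H y hy).2.2.2.2 t v ht hv
  have hPg := fun y hy g v => mem_push_iff_of_mem_iff_tendsto (P := P) (y := y) (v := v) hX hx hμ
    (fun y hy v => mem_iff_tendsto_nlen (Q := Q) (v := v) hX hx 1 ha hTP hsup hQi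
      (by simpa using hPc) (by simpa using hQc) hy) hy g
  have hQg := fun y hy g v => mem_push_iff_of_mem_iff_tendsto (P := Q) (y := y) (v := v) hX hx hμ
    (fun y hy v => mem_iff_tendsto_nlen (Q := P) (v := v) hX hx (-1) ha hTQ
      (fun y hy => by rw [sup_comm, hsup y hy]) hPi
      (by simpa using hQc) (by simpa using hPc) hy) hy g
  have hinv : ∀ R : M → Submodule ℝ E, (∀ y, orbitDir F G E y ≤ R y) →
      (∀ y ∈ MulAction.orbit G x, ∀ t, ∀ v ∈ R y, flowD X t y v ∈ R (flowMap X t y)) →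
      (∀ y ∈ MulAction.orbit G x, ∀ (g : G) v, push E g y v ∈ R (g • y) ↔ v ∈ R y) →
      ∀ y ∈ MulAction.orbit G x, ∀ t, ∀ v ∈ R y, flowD Y t y v ∈ R (flowMap Y t y) := by
    intro R hT hi hg y hy t v hv
    obtain ⟨hr, hm⟩ := hxY.reach hY hy t
    obtain ⟨g, hgq, hw⟩ := hXY.exists_flowD_eq hX hY hr
    obtain ⟨w, hw, hvw⟩ := hw v
    have h1 := hi y hy t v hv
    rw [hgq, hvw] at h1
    -- The flow of `X` gives `g • TΦ^Y_t v + w ∈ R`; drop the orbit direction `w`, then cancel `g`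
    -- by invariance of `R`.
    exact (hg _ hm g _).1 ((Submodule.add_mem_iff_left _ (hT _ hw)).1 h1)
  have hlen : ∀ y ∈ MulAction.orbit G x, ∀ t v, nlen F G μ (flowMap Y t y) (flowD Y t y v) =
      nlen F G μ (flowMap X t y) (flowD X t y v) := by
    intro y hy t v
    obtain ⟨hr, hm⟩ := hxY.reach hY hy t
    obtain ⟨g, hgq, hw⟩ := hXY.exists_flowD_eq hX hY hr
    obtain ⟨w, hw, hvw⟩ := hw v
    rw [hgq, hvw, nlen_add_mem _ _ hw, hμ.nlen_push]
  refine ⟨hxY, μ, Ns, Nu, C, a, hμ, hC, ha, fun y hy => ⟨(H y hy).1, hinv P hTP hPi hPg y hy,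
    hinv Q hTQ hQi hQg y hy, fun t v ht hv => ?_, fun t v ht hv => ?_⟩⟩
  · exact (hlen y hy t v).trans_le (hPc y hy t ht v hv)
  · exact (hlen y hy (-t) v).trans_le (hQc y hy t ht v hv)

end Hyperbolic

/-! ### Invariant complements for one-parameter groups of linear maps. -/

section Linear

variable {E : Type*} [NormedAddCommGroup E] [NormedSpace ℝ E] [FiniteDimensional ℝ E]
  {V : Type*} [NormedAddCommGroup V] [NormedSpace ℝ V] [FiniteDimensional ℝ V]

theorem exists_forall_norm_le (f : V →ₗ[ℝ] E) : ∃ c > 0, ∀ v, ‖f v‖ ≤ c * ‖v‖ := by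
  refine ⟨max ‖f.toContinuousLinearMap‖ 1, by positivity, fun v => ?_⟩
  refine (f.toContinuousLinearMap.le_opNorm v).trans ?_
  gcongr
  exact le_max_left _ _

variable {A : ℝ → E →ₗ[ℝ] E} {B : ℝ → V →ₗ[ℝ] V} {T : Submodule ℝ E} {C a : ℝ}

/-- Intertwining gives `K = A (-n) K B n` for every natural `n`. Here `A (-n)` is bounded on `T` and
`B n` tends to `0`, so `K = 0`. -/
theorem eq_zero_of_intertwines (hA0 : ∀ v, A 0 v = v)
    (hA : ∀ s t v, A (s + t) v = A s (A t v)) (hB0 : ∀ v, B 0 v = v)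
    (hB : ∀ s t v, B (s + t) v = B s (B t v))
    (hTC : ∀ t, ∀ w ∈ T, ‖A t w‖ ≤ C * ‖w‖) (ha : 0 < a)
    (hBC : ∀ t, 0 ≤ t → ∀ v, ‖B t v‖ ≤ C * Real.exp (-a * t) * ‖v‖) {K : V →ₗ[ℝ] E}
    (hK : ∀ v, K v ∈ T) (hc : ∀ v, A 1 (K v) = K (B 1 v)) : K = 0 := by
  have hn : ∀ (n : ℕ) v, A n (K v) = K (B n v) := by
    intro n
    induction n with
    | zero => intro v; simp [hA0, hB0]
    | succ n ih =>
      intro v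
      rw [Nat.cast_succ, hA, hc, ih, ← hB]
  obtain ⟨c, hc, hcK⟩ := exists_forall_norm_le K
  ext v
  have hC : ∀ n : ℕ, ‖K v‖ ≤ |C| * (c * (|C| * ‖v‖)) * Real.exp (-a * n) := by
    intro n
    have e : K v = A (-n) (K (B n v)) := by rw [← hn, ← hA, neg_add_cancel, hA0]
    rw [e]
    calc ‖A (-n) (K (B n v))‖ ≤ C * ‖K (B n v)‖ := hTC _ _ (hK _)
      _ ≤ |C| * (c * (|C| * Real.exp (-a * n) * ‖v‖)) := by
        gcongr
        · exact le_abs_self C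
        · refine (hcK _).trans ?_
          gcongr
          refine (hBC n n.cast_nonneg v).trans ?_
          gcongr
          exact le_abs_self C
      _ = _ := by ring
  have := ge_of_tendsto'
    ((tendsto_const_mul_exp_neg ha (|C| * (c * (|C| * ‖v‖)))).comp tendsto_natCast_atTop_atTop) hC
  simpa using this

/-- A one-parameter group of linear maps that is bounded on an invariant subspace `T` and that
contracts `S` modulo `T` contracts an invariant complement of `T` in `T ⊔ S`. -/
theorem exists_invariant_complement {S : Submodule ℝ E} (hA0 : ∀ v, A 0 v = v)
    (hA : ∀ s t v, A (s + t) v = A s (A t v)) (hT : ∀ t, ∀ w ∈ T, A t w ∈ T)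
    (hTC : ∀ t, ∀ w ∈ T, ‖A t w‖ ≤ C * ‖w‖) (hTS : Disjoint T S)
    (hS : ∀ t, ∀ v ∈ S, ∃ u ∈ S, A t v - u ∈ T ∧
      (0 ≤ t → ‖u‖ ≤ C * Real.exp (-a * t) * ‖v‖)) (ha : 0 < a) :
    ∃ S' : Submodule ℝ E, Disjoint T S' ∧ T ⊔ S' = T ⊔ S ∧ (∀ t, ∀ v ∈ S', A t v ∈ S') ∧
      ∃ C' > 0, ∀ t, 0 ≤ t → ∀ v ∈ S', ‖A t v‖ ≤ C' * Real.exp (-a * t) * ‖v‖ := by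
  obtain ⟨q, hqS, hqT⟩ : ∃ q : E →ₗ[ℝ] S, (∀ v : S, q v = v) ∧ ∀ w ∈ T, q w = 0 := by
    obtain ⟨T', hTT', hc⟩ := hTS.exists_isCompl
    refine ⟨S.projectionOnto T' hc.symm, fun v => ?_, fun w hw => ?_⟩
    · simp
    · simpa using hTT' hw
  -- `B` is the action of `A` on `(T ⊔ S) / T`, read on the representatives `S`; invariance of `T`
  -- makes it a one-parameter group.
  let B : ℝ → S →ₗ[ℝ] S := fun t => q ∘ₗ A t ∘ₗ S.subtype
  have hq : ∀ {v : E} {u : S}, v - u ∈ T → q v = u := fun {v u} h => by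
    have := hqT _ h
    rwa [map_sub, hqS, sub_eq_zero] at this
  have hAB : ∀ t (v : S), A t v - B t v ∈ T := fun t v => by
    obtain ⟨u, hu, h, -⟩ := hS t v v.2
    have : B t v = ⟨u, hu⟩ := hq h
    rwa [this]
  have hBC : ∀ t, 0 ≤ t → ∀ v, ‖B t v‖ ≤ C * Real.exp (-a * t) * ‖v‖ := fun t ht v => by
    obtain ⟨u, hu, h, h'⟩ := hS t v v.2
    have : B t v = ⟨u, hu⟩ := hq h
    rw [this]
    exact h' ht
  have hB0 : ∀ v, B 0 v = v := fun v => hq (by simp [hA0])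
  have hB : ∀ s t v, B (s + t) v = B s (B t v) := fun s t v => hq <| by
    have e : A (s + t) v - B s (B t v) =
        A s (A t v - B t v) + (A s (B t v) - B s (B t v)) := by
      rw [hA, map_sub]; abel
    change A (s + t) v - B s (B t v) ∈ T
    rw [e]
    exact add_mem (hT _ _ (hAB _ _)) (hAB _ _)
  -- The Sylvester operator `L ↦ A₁ L - L B₁`. Its kernel consists of intertwiners, hence is zero,
  -- and in finite dimension injectivity gives surjectivity.
  let Φ : (S →ₗ[ℝ] T) →ₗ[ℝ] (S →ₗ[ℝ] T) :=
    { toFun := fun L => (A 1).restrict (hT 1) ∘ₗ L - L ∘ₗ B 1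
      map_add' := fun L L' => by ext v; simp; abel
      map_smul' := fun c L => by ext v; simp [smul_sub] }
  have hΦ : ∀ L v, (Φ L v : E) = A 1 (L v) - L (B 1 v) := fun L v => rfl
  have hinj : Function.Injective Φ := by
    refine (injective_iff_map_eq_zero Φ).2 fun L hL => ?_
    have := eq_zero_of_intertwines (K := T.subtype ∘ₗ L) hA0 hA hB0 hB hTC ha hBC
      (fun v => (L v).2) fun v => by
        have := hΦ L v
        rw [hL] at this
        exact (sub_eq_zero.1 this.symm)
    ext v
    exact DFunLike.congr_fun this v
  -- The right-hand side is `B₁ - A₁` on `S`, chosen so that the graph map `J = id + L` satisfies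
  -- `A₁ J = J B₁`.
  obtain ⟨L, hL⟩ := (LinearMap.injective_iff_surjective.1 hinj)
    (LinearMap.codRestrict T (S.subtype ∘ₗ B 1 - A 1 ∘ₗ S.subtype) fun v => by
      have := neg_mem (hAB 1 v)
      rwa [neg_sub] at this)
  let J : S →ₗ[ℝ] E := S.subtype + T.subtype ∘ₗ L
  have hJ : ∀ v : S, J v - v ∈ T := fun v => by simp [J]
  have hJ1 : ∀ v, A 1 (J v) = J (B 1 v) := fun v => by
    have h1 := hΦ L v
    rw [hL] at h1
    have h2 : (B 1 v : E) - A 1 v = A 1 (L v) - L (B 1 v) := h1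
    change A 1 (v + L v) = B 1 v + L (B 1 v)
    rw [map_add, ← sub_eq_zero, ← neg_eq_zero, ← sub_eq_zero.2 h2]
    abel
  have hJt : ∀ t v, A t (J v) = J (B t v) := by
    intro t
    -- `A_t J B_{-t}` also intertwines `A₁` with `B₁` and is congruent to `J` modulo `T`, so by
    -- uniqueness it equals `J`. Invariance at time `1` thus extends to every `t`.
    have hK : A t ∘ₗ J ∘ₗ B (-t) - J = 0 := by
      refine eq_zero_of_intertwines hA0 hA hB0 hB hTC ha hBC (fun v => ?_) fun v => ?_
      · have e : (A t ∘ₗ J ∘ₗ B (-t) - J) v = A t (J (B (-t) v) - B (-t) v) +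
            (A t (B (-t) v) - B t (B (-t) v)) - (J v - v) := by
          rw [← hB, add_neg_cancel, hB0]
          simp
        rw [e]
        exact sub_mem (add_mem (hT _ _ (hJ _)) (hAB _ _)) (hJ _)
      · simp only [LinearMap.sub_apply, LinearMap.comp_apply, map_sub, hJ1]
        rw [← hA, add_comm, hA, hJ1, ← hB, ← hB, add_comm]
    intro v
    have := DFunLike.congr_fun hK (B t v)
    simpa [← hB, hB0, sub_eq_zero] using this
  obtain ⟨c, hc, hcJ⟩ := exists_forall_norm_le J
  obtain ⟨d, hd, hdq⟩ := exists_forall_norm_le q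
  have hqJ : ∀ v, q (J v) = v := fun v => hq (hJ v)
  refine ⟨LinearMap.range J, ?_, ?_, ?_, c * (|C| + 1) * d, by positivity, ?_⟩
  · rw [Submodule.disjoint_def]
    rintro _ h ⟨v, rfl⟩
    rw [← hqJ v, hqT _ h]
    simp
  · refine le_antisymm (sup_le le_sup_left ?_) (sup_le le_sup_left ?_)
    · rintro _ ⟨v, rfl⟩
      exact (sub_add_cancel (J v) (v : E)) ▸ Submodule.add_mem_sup (hJ v) v.2
    · intro v hv
      have := hJ ⟨v, hv⟩
      have h2 := Submodule.add_mem_sup (neg_mem this) (LinearMap.mem_range_self J ⟨v, hv⟩)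
      simpa using h2
  · rintro t _ ⟨v, rfl⟩
    exact ⟨B t v, (hJt t v).symm⟩
  · rintro t ht _ ⟨v, rfl⟩
    rw [hJt]
    calc ‖J (B t v)‖ ≤ c * ((|C| + 1) * Real.exp (-a * t) * (d * ‖J v‖)) := by
          refine (hcJ _).trans ?_
          gcongr
          refine (hBC t ht v).trans ?_
          gcongr
          · exact (le_abs_self C).trans (by linarith)
          · simpa [hqJ] using hdq (J v)
      _ = _ := by ring

end Linear

/-! ### Compactness of the group and uniform bounds along a compact orbit. -/

section Compact

/-- Under the proper map `(g, y) ↦ (g • y, y)` the preimage of the compact set `G•x × {x}` is `G ×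
{x}`. -/
theorem compactSpace_of_isCompact_orbit {G M : Type*} [Group G] [TopologicalSpace G]
    [TopologicalSpace M] [MulAction G M] [ProperSMul G M] {x : M}
    (hx : IsCompact (MulAction.orbit G x)) : CompactSpace G := by
  have h := (ProperSMul.isProperMap_smul_pair (G := G) (X := M)).isCompact_preimage
    (hx.prod (isCompact_singleton (x := x)))
  refine ⟨(h.image continuous_fst).of_isClosed_subset isClosed_univ fun g _ => ?_⟩
  exact ⟨(g, x), ⟨⟨g, rfl⟩, rfl⟩, rfl⟩

variable {F : Type*} [NormedAddCommGroup F] [NormedSpace ℝ F]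
  {G : Type*} [TopologicalSpace G] [ChartedSpace F G] [Group G] [LieGroup 𝓘(ℝ, F) ∞ G]
  {E : Type*} [NormedAddCommGroup E] [NormedSpace ℝ E]
  {M : Type*} [TopologicalSpace M] [ChartedSpace E M] [IsManifold 𝓘(ℝ, E) ∞ M]
  [MulAction G M] [ContMDiffSMul 𝓘(ℝ, F) 𝓘(ℝ, E) ∞ G M]

include F in
variable (F G E) in
theorem contMDiff_push (x : M) :
    ContMDiff (𝓘(ℝ, F).prod 𝓘(ℝ, E)) 𝓘(ℝ, E).tangent ∞
      (fun p : G × E => (⟨p.1 • x, push E p.1 x p.2⟩ : TangentBundle 𝓘(ℝ, E) M)) := by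
  have h0 : ContMDiff (𝓘(ℝ, F).prod 𝓘(ℝ, E)) 𝓘(ℝ, F).tangent ∞
      (fun p : G × E => (⟨p.1, 0⟩ : TangentBundle 𝓘(ℝ, F) G)) :=
    (Bundle.contMDiff_zeroSection ℝ (TangentSpace 𝓘(ℝ, F) : G → Type _)).comp contMDiff_fst
  have h1 : ContMDiff (𝓘(ℝ, F).prod 𝓘(ℝ, E)) 𝓘(ℝ, E).tangent ∞
      (fun p : G × E => (⟨x, p.2⟩ : TangentBundle 𝓘(ℝ, E) M)) :=
    (contMDiff_tangent_mk x).comp contMDiff_snd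
  have h2 : ContMDiff (𝓘(ℝ, F).prod 𝓘(ℝ, E)).tangent 𝓘(ℝ, E).tangent ∞
      (tangentMap (𝓘(ℝ, F).prod 𝓘(ℝ, E)) 𝓘(ℝ, E) (fun p : G × M => p.1 • p.2)) :=
    (contMDiff_smul (I := 𝓘(ℝ, F)) (I' := 𝓘(ℝ, E)) (n := ∞)).contMDiff_tangentMap (by simp)
  refine ((h2.comp contMDiff_equivTangentBundleProd_symm).comp (h0.prodMk h1)).congr fun p => ?_
  have h3 := plainDeriv_smul (F := F) p.1 x 0 p.2
  rw [map_zero, zero_add] at h3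
  rw [← h3]
  rfl

-- The tangent map of the action at `(1, g • x)`, applied to vectors of the form `(ζ, 0)`.
variable (F G E) in
theorem contMDiff_infAct (x : M) :
    ContMDiff (𝓘(ℝ, F).prod 𝓘(ℝ, F)) 𝓘(ℝ, E).tangent ∞
      (fun p : G × F => (⟨p.1 • x, infAct F G E (p.1 • x) p.2⟩ : TangentBundle 𝓘(ℝ, E) M)) := by
  have h0 : ContMDiff (𝓘(ℝ, F).prod 𝓘(ℝ, F)) 𝓘(ℝ, E).tangent ∞
      (fun p : G × F => (⟨p.1 • x, 0⟩ : TangentBundle 𝓘(ℝ, E) M)) :=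
    (Bundle.contMDiff_zeroSection ℝ (TangentSpace 𝓘(ℝ, E) : M → Type _)).comp
      (contMDiff_fst.smul contMDiff_const)
  have h1 : ContMDiff (𝓘(ℝ, F).prod 𝓘(ℝ, F)) 𝓘(ℝ, F).tangent ∞
      (fun p : G × F => (⟨1, p.2⟩ : TangentBundle 𝓘(ℝ, F) G)) :=
    (contMDiff_tangent_mk 1).comp contMDiff_snd
  have h2 : ContMDiff (𝓘(ℝ, F).prod 𝓘(ℝ, E)).tangent 𝓘(ℝ, E).tangent ∞
      (tangentMap (𝓘(ℝ, F).prod 𝓘(ℝ, E)) 𝓘(ℝ, E) (fun p : G × M => p.1 • p.2)) :=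
    (contMDiff_smul (I := 𝓘(ℝ, F)) (I' := 𝓘(ℝ, E)) (n := ∞)).contMDiff_tangentMap (by simp)
  refine ((h2.comp contMDiff_equivTangentBundleProd_symm).comp (h1.prodMk h0)).congr fun p => ?_
  have h3 := plainDeriv_smul (F := F) (1 : G) (p.1 • x) p.2 (0 : E)
  rw [map_zero, add_zero] at h3
  have hbase : ∀ (a b : M) (w w' : E), a = b → w = w' →
      (⟨a, w⟩ : TangentBundle 𝓘(ℝ, E) M) = ⟨b, w'⟩ := by
    rintro a b w w' rfl rfl; rfl
  exact hbase _ _ _ _ (one_smul G _).symm h3.symm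

variable [FiniteDimensional ℝ F] [FiniteDimensional ℝ E] [CompactSpace G] (μ : Metric E M)

include F in
variable (F G) in
theorem Metric.exists_len_push_bounds (x : M) : ∃ k > 0, ∃ K > 0, ∀ (g : G) (v : E),
    k * ‖v‖ ≤ μ.len (g • x) (push E g x v) ∧ μ.len (g • x) (push E g x v) ≤ K * ‖v‖ := by
  have hc : Continuous fun p : G × E => μ.len (p.1 • x) (push E p.1 x p.2) :=
    μ.continuous_len (contMDiff_push F G E x).continuous
  have hs : ∀ (g : G) (v : E) (c : ℝ), μ.len (g • x) (push E g x (c • v)) =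
      |c| * μ.len (g • x) (push E g x v) := fun g v c => by rw [map_smul, μ.len_smul]
  obtain ⟨K, hK, h1⟩ := exists_forall_le_mul_norm
    (Q := fun (g : G) v => μ.len (g • x) (push E g x v)) hc hs
  obtain ⟨k, hk, h2⟩ := exists_forall_mul_norm_le
    (Q := fun (g : G) v => μ.len (g • x) (push E g x v)) hc hs
    fun g v hv => μ.len_pos _ fun h => hv <| by
    rw [← push_inv_push F g x v, h, map_zero]
  exact ⟨k, hk, K, hK, fun g v => ⟨h2 g v, h1 g v⟩⟩

variable (F G) in
theorem Metric.exists_len_infAct_le (x : M) : ∃ K > 0, ∀ (g : G) (ζ : F),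
    μ.len (g • x) (infAct F G E (g • x) ζ) ≤ K * ‖ζ‖ :=
  exists_forall_le_mul_norm (Q := fun (g : G) ζ => μ.len (g • x) (infAct F G E (g • x) ζ))
    (μ.continuous_len (contMDiff_infAct F G E x).continuous)
    fun g v c => by rw [map_smul, μ.len_smul]

end Compact

/-! ### Characterization of the contracted summand by its rate. -/

section Decay

variable {E : Type*} [NormedAddCommGroup E] [NormedSpace ℝ E]

/-- If a space splits into a part `T` of slow growth, a part `P` that is contracted and a part `Q`
that is expanded, then `P` is characterized by the rate of contraction. -/
theorem mem_iff_exists_forall_le {ℓ : ℝ → E → ℝ} {n : E → ℝ} (hn : ∀ v, n v ≤ 0 → v = 0)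
    (hsub : ∀ t v w, ℓ t (v - w) ≤ ℓ t v + ℓ t w) {T P Q : Submodule ℝ E} (htop : T ⊔ (P ⊔ Q) = ⊤)
    {C a b : ℝ} (hC : 0 < C) (hb : 0 ≤ b) (hba : b < a)
    (hP : ∀ t, 0 ≤ t → ∀ v ∈ P, ℓ t v ≤ C * Real.exp (-a * t) * n v)
    (hQ : ∀ t, 0 ≤ t → ∀ v ∈ Q, n v ≤ C * Real.exp (-a * t) * ℓ t v)
    (hT : ∀ t, 0 ≤ t → ∀ v ∈ T, ℓ t v ≤ C * Real.exp (b * t) * n v)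
    (hT' : ∀ t, 0 ≤ t → ∀ v ∈ T, n v ≤ C * Real.exp (b * t) * ℓ t v) {v : E} :
    v ∈ P ↔ ∃ D, ∀ t, 0 ≤ t → ℓ t v ≤ D * Real.exp (-a * t) := by
  refine ⟨fun hv => ⟨C * n v, fun t ht => (hP t ht v hv).trans_eq (by ring)⟩, ?_⟩
  rintro ⟨D, hD⟩
  obtain ⟨w, hw, z, hz, rfl⟩ := Submodule.mem_sup.1 (htop.symm ▸ Submodule.mem_top : v ∈ _)
  obtain ⟨p, hp, q, hq, rfl⟩ := Submodule.mem_sup.1 hz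
  have h1 : ∀ t, 0 ≤ t → ℓ t (w + q) ≤ (D + C * n p) * Real.exp (-a * t) := fun t ht => by
    have e : w + q = w + (p + q) - p := by abel
    rw [e]
    linarith [hsub t (w + (p + q)) p, hD t ht, hP t ht p hp]
  -- Tending to `0` would not suffice here, since vectors of `T` may decay at rate `b`; decay at
  -- rate `a > b` does. Without `p`, the vector `q` grows at most like `e^{bt}`, but `Q` expands at
  -- rate `a`.
  have hq0 : q = 0 := hn q <| by
    refine ge_of_tendsto ((tendsto_const_mul_exp_neg (sub_pos.2 hba)
      (C * (|D + C * n p| + C * |n w|)))) ((eventually_ge_atTop 0).mono fun t ht => ?_)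
    have h2 : ℓ t q ≤ (|D + C * n p| + C * |n w|) * Real.exp (b * t) := by
      have e : q = w + q - w := by abel
      have h3 : (D + C * n p) * Real.exp (-a * t) ≤ |D + C * n p| * Real.exp (b * t) := by
        gcongr
        · exact le_abs_self _
        · linarith
      have h4 : C * Real.exp (b * t) * n w ≤ C * Real.exp (b * t) * |n w| := by
        gcongr; exact le_abs_self _
      have h5 := hsub t (w + q) w
      rw [← e] at h5
      linarith [h1 t ht, hT t ht w hw]
    calc n q ≤ C * Real.exp (-a * t) * ℓ t q := hQ t ht q hq
      _ ≤ C * Real.exp (-a * t) * ((|D + C * n p| + C * |n w|) * Real.exp (b * t)) := by gcongr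
      _ = C * (|D + C * n p| + C * |n w|) * Real.exp (-(a - b) * t) := by
        rw [show -(a - b) * t = -a * t + b * t by ring, Real.exp_add]; ring
  subst hq0
  -- Now `w` decays at rate `a`, although vectors of `T` shrink at most at rate `b`.
  have hw0 : w = 0 := hn w <| by
    refine ge_of_tendsto ((tendsto_const_mul_exp_neg (sub_pos.2 hba) (C * (D + C * n p))))
      ((eventually_ge_atTop 0).mono fun t ht => ?_)
    have h2 := h1 t ht
    rw [add_zero] at h2
    calc n w ≤ C * Real.exp (b * t) * ℓ t w := hT' t ht w hw
      _ ≤ C * Real.exp (b * t) * ((D + C * n p) * Real.exp (-a * t)) := by gcongr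
      _ = C * (D + C * n p) * Real.exp (-(a - b) * t) := by
        rw [show -(a - b) * t = -a * t + b * t by ring, Real.exp_add]; ring
  simpa [hw0] using hp

end Decay

/-! ### Decay subspaces and the linear group at a relative equilibrium with compact orbit. -/

section CompactOrbit

variable {F : Type*} [NormedAddCommGroup F] [NormedSpace ℝ F] [FiniteDimensional ℝ F]
  {G : Type*} [TopologicalSpace G] [ChartedSpace F G] [Group G] [LieGroup 𝓘(ℝ, F) ∞ G]
  {E : Type*} [NormedAddCommGroup E] [NormedSpace ℝ E] [FiniteDimensional ℝ E]
  {M : Type*} [TopologicalSpace M] [T2Space M] [ChartedSpace E M] [IsManifold 𝓘(ℝ, E) ∞ M]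
  [MulAction G M] [ContMDiffSMul 𝓘(ℝ, F) 𝓘(ℝ, E) ∞ G M]
  {X Y Z : (m : M) → TangentSpace 𝓘(ℝ, E) m} {μ : Metric E M} {x y : M} {σ a b C k K : ℝ}

/-- The tangent vectors at `y` whose length decays with rate `a` along the flow of `Z`, in positive
time if `σ = 1` and in negative time if `σ = -1`. -/
noncomputable def decay (μ : Metric E M) (Z : (m : M) → TangentSpace 𝓘(ℝ, E) m) (σ a : ℝ) (y : M) :
    Submodule ℝ E where
  carrier := {v | ∃ D, ∀ t, 0 ≤ t →
    μ.len (flowMap Z (σ * t) y) (flowD Z (σ * t) y v) ≤ D * Real.exp (-a * t)}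
  add_mem' := by
    rintro v w ⟨D, hD⟩ ⟨D', hD'⟩
    refine ⟨D + D', fun t ht => ?_⟩
    rw [map_add]
    linarith [hD t ht, hD' t ht,
      μ.len_add_le (flowMap Z (σ * t) y) (flowD Z (σ * t) y v) (flowD Z (σ * t) y w)]
  zero_mem' := ⟨0, fun t ht => by
    have := μ.len_smul (flowMap Z (σ * t) y) 0 0
    rw [zero_smul, abs_zero, zero_mul] at this
    rw [map_zero, this, zero_mul]⟩
  smul_mem' := by
    rintro c v ⟨D, hD⟩
    refine ⟨|c| * D, fun t ht => ?_⟩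
    rw [map_smul, μ.len_smul, mul_assoc]
    exact mul_le_mul_of_nonneg_left (hD t ht) (abs_nonneg c)

theorem mem_decay {v : E} : v ∈ decay μ Z σ a y ↔ ∃ D, ∀ t, 0 ≤ t →
    μ.len (flowMap Z (σ * t) y) (flowD Z (σ * t) y v) ≤ D * Real.exp (-a * t) := Iff.rfl

/-- The contracted summand of a splitting along the orbit of a relative equilibrium is
characterized by the rate of contraction. -/
theorem mem_iff_mem_decay (hX : IsInvariantVectorField G X) (hx : IsRelativeEquilibrium F G X x)
    {P Q : M → Submodule ℝ E} (hσ : |σ| = 1) (hC : 0 < C) (hb : 0 ≤ b) (hba : b < a)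
    (htop : ∀ y ∈ MulAction.orbit G x, orbitDir F G E y ⊔ (P y ⊔ Q y) = ⊤)
    (hQ : ∀ y ∈ MulAction.orbit G x, ∀ t, ∀ v ∈ Q y, flowD X t y v ∈ Q (flowMap X t y))
    (hPc : ∀ y ∈ MulAction.orbit G x, ∀ t, 0 ≤ t → ∀ v ∈ P y,
      μ.len (flowMap X (σ * t) y) (flowD X (σ * t) y v) ≤
        C * Real.exp (-a * t) * μ.len y v)
    (hQc : ∀ y ∈ MulAction.orbit G x, ∀ t, 0 ≤ t → ∀ v ∈ Q y,
      μ.len (flowMap X (-(σ * t)) y) (flowD X (-(σ * t)) y v) ≤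
        C * Real.exp (-a * t) * μ.len y v)
    (hTc : ∀ y ∈ MulAction.orbit G x, ∀ t, ∀ v ∈ orbitDir F G E y,
      μ.len (flowMap X t y) (flowD X t y v) ≤ C * Real.exp (b * |t|) * μ.len y v)
    (hy : y ∈ MulAction.orbit G x) {v : E} : v ∈ P y ↔ v ∈ decay μ X σ a y := by
  have habs : ∀ t, 0 ≤ t → |σ * t| = t := fun t ht => by rw [abs_mul, hσ, one_mul, abs_of_nonneg ht]
  have hback : ∀ t v, flowD X (-t) (flowMap X t y) (flowD X t y v) = v ∧
      flowMap X (-t) (flowMap X t y) = y := fun t v => by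
    have hr := (hx.reach hX hy t).1
    refine ⟨?_, hr.symm.flowMap_eq hX.smoothField⟩
    rw [← flowD_add hX.smoothField hr hr.symm, add_neg_cancel, flowD_zero hX.smoothField]
    rfl
  refine mem_iff_exists_forall_le
    (ℓ := fun t v => μ.len (flowMap X (σ * t) y) (flowD X (σ * t) y v))
    (n := μ.len y) (fun v hv => ?_) (fun t v w => ?_) (htop y hy) hC hb hba (hPc y hy)
    (fun t ht v hv => ?_) (fun t ht v hv => ?_) (fun t ht v hv => ?_)
  · by_contra h
    exact (μ.len_pos y h).not_ge hv
  · rw [map_sub]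
    exact μ.len_sub_le _ _ _
  · obtain ⟨hr, hm⟩ := hx.reach hX hy (σ * t)
    have := hQc _ hm t ht _ (hQ y hy (σ * t) v hv)
    rwa [(hback _ v).1, (hback _ v).2] at this
  · have := hTc y hy (σ * t) v hv
    rwa [habs t ht] at this
  · obtain ⟨hr, hm⟩ := hx.reach hX hy (σ * t)
    obtain ⟨ζ, rfl⟩ := mem_orbitDir.1 hv
    -- The tangential bound is applied backwards from the later point; the vector is still tangent
    -- there because generators are preserved.
    have := hTc _ hm (-(σ * t)) _ (mem_orbitDir.2 ⟨ζ, (flowD_infAct hX hr ζ).symm⟩)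
    rwa [(hback _ _).1, (hback (σ * t) 0).2, abs_neg, habs t ht] at this

/-- The action distorts the lengths of tangent vectors at the points of a compact orbit by a bounded
factor. -/
def BoundedDistortion (G : Type*) [Group G] [MulAction G M] (μ : Metric E M) (x : M) (k K : ℝ) :
    Prop :=
  ∀ (g : G) (v : E), k * ‖v‖ ≤ μ.len (g • x) (push E g x v) ∧
    μ.len (g • x) (push E g x v) ≤ K * ‖v‖

include F in
theorem BoundedDistortion.len_push_le (h : BoundedDistortion G μ x k K) (hk : 0 < k) (hK : 0 < K)
    (hy : y ∈ MulAction.orbit G x) (g : G) (v : E) :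
    μ.len (g • y) (push E g y v) ≤ K / k * μ.len y v := by
  obtain ⟨l, rfl⟩ := hy
  change μ.len (g • l • x) (push E g (l • x) v) ≤ K / k * μ.len (l • x) v
  obtain ⟨u, rfl⟩ : ∃ u, push E l x u = v := ⟨_, push_push_inv F l x v⟩
  rw [push_mul_apply F, ← mul_smul]
  refine (h _ u).2.trans ?_
  rw [div_mul_eq_mul_div, le_div_iff₀ hk, mul_assoc]
  have := (h l u).1
  gcongr
  linarith

/-- The action need not be isometric, but its distortion factor `K / k` is absorbed into the
constant of the decay estimate. -/
theorem push_mem_decay_iff (hX : IsInvariantVectorField G X) (hx : IsRelativeEquilibrium F G X x)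
    (h : BoundedDistortion G μ x k K) (hk : 0 < k) (hK : 0 < K) (hy : y ∈ MulAction.orbit G x)
    (g : G) {v : E} : push E g y v ∈ decay μ X σ a (g • y) ↔ v ∈ decay μ X σ a y := by
  have key : ∀ y ∈ MulAction.orbit G x, ∀ (g : G) (v : E), v ∈ decay μ X σ a y →
      push E g y v ∈ decay μ X σ a (g • y) := by
    rintro y hy g v ⟨D, hD⟩
    refine ⟨K / k * D, fun t ht => ?_⟩
    obtain ⟨hr, hm⟩ := hx.reach hX hy (σ * t)
    rw [flowMap_smul F hX, flowD_smul F hX g hr, mul_assoc]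
    exact (h.len_push_le (F := F) hk hK hm g _).trans
      (mul_le_mul_of_nonneg_left (hD t ht) (by positivity))
  refine ⟨fun hv => ?_, key y hy g v⟩
  have := key (g • y) ?_ g⁻¹ _ hv
  · rwa [push_inv_push F, inv_smul_smul] at this
  · obtain ⟨l, rfl⟩ := hy
    exact ⟨g * l, mul_smul _ _ _⟩

/-- The linearized flow at a relative equilibrium, composed with the elements of a one-parameter
group that move the trajectory back to its origin. -/
theorem exists_linear_group (hY : IsInvariantVectorField G Y)
    (hx : IsRelativeEquilibrium F G Y x) : ∃ (f : ℝ → G) (A : ℝ → E →ₗ[ℝ] E),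
    (∀ v, A 0 v = v) ∧ (∀ s t v, A (s + t) v = A s (A t v)) ∧ (∀ t, Reach Y t x (f t • x)) ∧
      ∀ t v, flowD Y t x v = push E (f t) x (A t v) := by
  obtain ⟨f, hf, hr⟩ := exists_oneParam hY hx
  let A : ℝ → E →ₗ[ℝ] E := fun t => ((push E (f t)⁻¹ (f t • x)).comp (flowD Y t x)).toLinearMap
  have hA : ∀ t v, flowD Y t x v = push E (f t) x (A t v) := fun t v =>
    (push_push_inv F (f t) x _).symm
  have hinj : ∀ (g : G) {v w : E}, push E g x v = push E g x w → v = w := fun g v w h => by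
    rw [← push_inv_push F g x v, h, push_inv_push F]
  refine ⟨f, A, fun v => ?_, fun s t v => ?_, hr, hA⟩
  · have h0 : f 0 = 1 := by simpa using hf 0 0
    have := hA 0 v
    rw [h0, push_one, flowD_zero hY.smoothField] at this
    exact this.symm
  · refine hinj (f (s + t)) ?_
    -- The group element commutes past the linearized flow by equivariance; together with `f (t + s)
    -- = f t * f s` this gives the group law.
    rw [← hA, add_comm s t, flowD_add hY.smoothField (hr t) ((hr s).smul F hY (f t)), hA t,
      flowD_smul F hY (f t) (hr s), hA s, push_mul_apply F, ← hf]

variable {f : ℝ → G} {A : ℝ → E →ₗ[ℝ] E}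

theorem linear_group_mem (hY : IsInvariantVectorField G Y) (hr : ∀ t, Reach Y t x (f t • x))
    (hA : ∀ t v, flowD Y t x v = push E (f t) x (A t v)) (t : ℝ) {w : E}
    (hw : w ∈ orbitDir F G E x) : A t w ∈ orbitDir F G E x := by
  rw [← push_mem_orbitDir_iff (f t), ← hA]
  obtain ⟨ζ, rfl⟩ := mem_orbitDir.1 hw
  exact mem_orbitDir.2 ⟨ζ, (flowD_infAct hY (hr t) ζ).symm⟩

/-- `A t` sends the generator of `ζ` at `x` to its value at `f t • x` pulled back to `x`, and both
operations are bounded uniformly over the group. A linear choice of `ζ` bounds `‖ζ‖` by the vector.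
-/
theorem exists_linear_group_le (hY : IsInvariantVectorField G Y) (hr : ∀ t, Reach Y t x (f t • x))
    (hA : ∀ t v, flowD Y t x v = push E (f t) x (A t v)) (h : BoundedDistortion G μ x k K)
    (hk : 0 < k) {K' : ℝ} (hK' : 0 < K')
    (h' : ∀ (g : G) (ζ : F), μ.len (g • x) (infAct F G E (g • x) ζ) ≤ K' * ‖ζ‖) :
    ∃ c > 0, ∀ t, ∀ w ∈ orbitDir F G E x, ‖A t w‖ ≤ c * ‖w‖ := by
  obtain ⟨s, hs⟩ := (infAct F G E x).toLinearMap.rangeRestrict.exists_rightInverse_of_surjective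
    (LinearMap.range_rangeRestrict _)
  obtain ⟨c, hc, hcs⟩ := exists_forall_norm_le s
  refine ⟨K' * c / k, by positivity, fun t w hw => ?_⟩
  let r : LinearMap.range (infAct F G E x).toLinearMap := ⟨w, mem_orbitDir.1 hw⟩
  have hsw : infAct F G E x (s r) = w := congrArg Subtype.val (DFunLike.congr_fun hs r)
  rw [div_mul_eq_mul_div, le_div_iff₀ hk, mul_comm _ k]
  refine ((h (f t) _).1).trans ?_
  rw [← hA, ← hsw, flowD_infAct hY (hr t), hsw, mul_assoc]
  refine (h' _ _).trans ?_
  gcongr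
  exact hcs r

/-- A subbundle that the flow of `X` contracts along the orbit of `x` can be replaced by one that
the flow of an isomorphic vector field contracts. -/
theorem exists_contracted_complement (hX : IsInvariantVectorField G X)
    (hY : IsInvariantVectorField G Y) (hXY : Isomorphic F G X Y)
    (hA0 : ∀ v, A 0 v = v) (hAa : ∀ s t v, A (s + t) v = A s (A t v))
    (hr : ∀ t, Reach Y t x (f t • x)) (hA : ∀ t v, flowD Y t x v = push E (f t) x (A t v))
    (h : BoundedDistortion G μ x k K) (hk : 0 < k)
    {c : ℝ} (hAT : ∀ t, ∀ w ∈ orbitDir F G E x, ‖A t w‖ ≤ c * ‖w‖)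
    (hσ : |σ| = 1) (ha : 0 < a) (hC : 0 < C) {P : M → Submodule ℝ E}
    (hTP : Disjoint (orbitDir F G E x) (P x))
    (hP : ∀ t, ∀ v ∈ P x, flowD X t x v ∈ P (flowMap X t x))
    (hPg : ∀ (g : G) v, push E g x v ∈ P (g • x) ↔ v ∈ P x)
    (hPc : ∀ t, 0 ≤ t → ∀ v ∈ P x,
      μ.len (flowMap X (σ * t) x) (flowD X (σ * t) x v) ≤ C * Real.exp (-a * t) * μ.len x v) :
    ∃ S : Submodule ℝ E, Disjoint (orbitDir F G E x) S ∧
      orbitDir F G E x ⊔ S = orbitDir F G E x ⊔ P x ∧ (∀ t, ∀ v ∈ S, A t v ∈ S) ∧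
      ∃ C' > 0, ∀ t, 0 ≤ t → ∀ v ∈ S, ‖A (σ * t) v‖ ≤ C' * Real.exp (-a * t) * ‖v‖ := by
  have hσ2 : σ * σ = 1 := by rw [← abs_mul_abs_self, hσ, one_mul]
  have hlen : ∀ v, μ.len x v ≤ K * ‖v‖ := fun v => by
    have := (h 1 v).2
    rwa [push_one, one_smul] at this
  have hS : ∀ t, ∀ v ∈ P x, ∃ u ∈ P x, A (σ * t) v - u ∈ orbitDir F G E x ∧
      (0 ≤ t → ‖u‖ ≤ max c (C * K / k) * Real.exp (-a * t) * ‖v‖) := by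
    intro t v hv
    obtain ⟨g, hg, hgv⟩ := hXY.exists_flowD_eq hX hY (hr (σ * t))
    obtain ⟨w, hw, hvw⟩ := hgv v
    rw [← mul_smul] at hg hw
    rw [hA, push_mul_apply F] at hvw
    -- `u` is the `X`-image of `v` moved back to `x`: equivariance of `P` puts it in `P x`, it is
    -- contracted up to distortion, and it differs from `A (σ * t) v` by an orbit direction.
    obtain ⟨u, hu⟩ : ∃ u, push E (g * f (σ * t)) x u = flowD X (σ * t) x v :=
      ⟨_, push_push_inv F _ x _⟩
    refine ⟨u, ?_, ?_, fun ht => ?_⟩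
    · rw [← hPg (g * f (σ * t)), hu, ← hg]
      exact hP _ v hv
    · rw [← push_mem_orbitDir_iff (g * f (σ * t)), map_sub, hu, hvw, sub_add_cancel_left]
      exact neg_mem hw
    · have h5 := (h (g * f (σ * t)) u).1
      have h6 := hPc t ht v hv
      rw [hu, ← hg] at h5
      have h7 : k * ‖u‖ ≤ C * Real.exp (-a * t) * (K * ‖v‖) :=
        (h5.trans h6).trans (by gcongr; exact hlen v)
      calc ‖u‖ ≤ C * K / k * Real.exp (-a * t) * ‖v‖ := by
            rw [div_mul_eq_mul_div, div_mul_eq_mul_div, le_div_iff₀ hk]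
            linarith
        _ ≤ _ := by gcongr; exact le_max_right _ _
  obtain ⟨S, h1, h2, h3, h4⟩ := exists_invariant_complement (A := fun t => A (σ * t))
    (by simpa using hA0) (fun s t v => by rw [mul_add, hAa])
    (fun t w hw => linear_group_mem hY hr hA _ hw)
    (fun t w hw => (hAT _ w hw).trans (by gcongr; exact le_max_left _ _)) hTP hS ha
  refine ⟨S, h1, h2, fun t v hv => ?_, h4⟩
  have := h3 (σ * t) v hv
  rwa [← mul_assoc, hσ2, one_mul] at this

end CompactOrbit

/-- Modulo `T` the new subspaces agree with the old ones, and independence of `T`, `S`, `U` gives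
`(T ⊔ S) ⊓ (T ⊔ U) = T`. -/
theorem disjoint_and_isCompl_of_sup_eq {E : Type*} [AddCommGroup E] [Module ℝ E]
    {T S U S' U' : Submodule ℝ E} (hSU : Disjoint S U) (hT : IsCompl T (S ⊔ U))
    (hS' : Disjoint T S') (hU' : Disjoint T U') (hTS : T ⊔ S' = T ⊔ S) (hTU : T ⊔ U' = T ⊔ U) :
    Disjoint S' U' ∧ IsCompl T (S' ⊔ U') := by
  rw [Submodule.disjoint_def] at hSU hS' hU'
  have hd := Submodule.disjoint_def.1 hT.disjoint
  have key : ∀ v, v ∈ T ⊔ S → v ∈ T ⊔ U → v ∈ T := fun v hv hv' => by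
    obtain ⟨w, hw, s, hs, rfl⟩ := Submodule.mem_sup.1 hv
    obtain ⟨w', hw', u, hu, h⟩ := Submodule.mem_sup.1 hv'
    have e : s - u = w' - w := by rw [sub_eq_sub_iff_add_eq_add, add_comm s, ← h]
    have h0 : s - u = 0 := hd _ (e ▸ sub_mem hw' hw)
      (sub_mem (Submodule.mem_sup_left hs) (Submodule.mem_sup_right hu))
    have hs0 : s = 0 := hSU s hs (by rwa [sub_eq_zero.1 h0])
    simpa [hs0] using hw
  rw [← hTS, ← hTU] at key
  refine ⟨Submodule.disjoint_def.2 fun v hv hv' =>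
    hS' v (key v (Submodule.mem_sup_right hv) (Submodule.mem_sup_right hv')) hv, ?_, ?_⟩
  · refine Submodule.disjoint_def.2 fun v hv hv' => ?_
    obtain ⟨s, hs, u, hu, rfl⟩ := Submodule.mem_sup.1 hv'
    have h1 : s ∈ T := key s (Submodule.mem_sup_right hs) <| by
      have := Submodule.add_mem_sup hv (neg_mem hu)
      rwa [add_neg_cancel_right] at this
    rw [hS' s h1 hs, zero_add] at hv ⊢
    exact hU' u hv hu
  · rw [codisjoint_iff, ← sup_assoc, hTS, sup_assoc, sup_left_comm, hTU, sup_left_comm]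
    exact hT.sup_eq_top

/-! ### Transport along the compact orbit and normal hyperbolicity for the isomorphic field. -/

section CompactOrbit

variable {F : Type*} [NormedAddCommGroup F] [NormedSpace ℝ F] [FiniteDimensional ℝ F]
  {G : Type*} [TopologicalSpace G] [ChartedSpace F G] [Group G] [LieGroup 𝓘(ℝ, F) ∞ G]
  {E : Type*} [NormedAddCommGroup E] [NormedSpace ℝ E] [FiniteDimensional ℝ E]
  {M : Type*} [TopologicalSpace M] [T2Space M] [ChartedSpace E M] [IsManifold 𝓘(ℝ, E) ∞ M]
  [MulAction G M] [ContMDiffSMul 𝓘(ℝ, F) 𝓘(ℝ, E) ∞ G M]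
  {X Y : (m : M) → TangentSpace 𝓘(ℝ, E) m} {μ : Metric E M} {x y : M} {σ a b C k K : ℝ}
  {f : ℝ → G} {A : ℝ → E →ₗ[ℝ] E}

omit [T2Space M] [FiniteDimensional ℝ F] [LieGroup 𝓘(ℝ, F) ∞ G] [FiniteDimensional ℝ E]
  [IsManifold 𝓘(ℝ, E) ∞ M] in
variable (F E) in
/-- The derivative at `m` of the diffeomorphism by which `g` acts, as an isomorphism. -/
noncomputable def pushEquiv (g : G) (m : M) : E ≃ₗ[ℝ] E where
  toLinearMap := (push E g m).toLinearMap
  invFun := push E g⁻¹ (g • m)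
  left_inv := push_inv_push F g m
  right_inv := push_push_inv F g m

theorem orbitDir_smul (g : G) (m : M) :
    orbitDir F G E (g • m) = (orbitDir F G E m).map (pushEquiv F E g m).toLinearMap := by
  ext v
  have := push_mem_orbitDir_iff (F := F) (m := m) g (v := (pushEquiv F E g m).symm v)
  refine Iff.trans ?_ (this.trans (Submodule.mem_map_equiv _).symm)
  exact Eq.to_iff (congrArg (· ∈ orbitDir F G E (g • m))
    ((pushEquiv F E g m).apply_symm_apply v).symm)

theorem decay_smul (hX : IsInvariantVectorField G X) (hx : IsRelativeEquilibrium F G X x)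
    (h : BoundedDistortion G μ x k K) (hk : 0 < k) (hK : 0 < K) (g : G) :
    decay μ X σ a (g • x) = (decay μ X σ a x).map (pushEquiv F E g x).toLinearMap := by
  ext v
  have := push_mem_decay_iff (σ := σ) (a := a) hX hx h hk hK (MulAction.mem_orbit_self x) g
    (v := (pushEquiv F E g x).symm v)
  refine Iff.trans ?_ (this.trans (Submodule.mem_map_equiv _).symm)
  exact Eq.to_iff (congrArg (· ∈ decay μ X σ a (g • x))
    ((pushEquiv F E g x).apply_symm_apply v).symm)

include F in
variable (F) in
theorem len_flowD_push (hY : IsInvariantVectorField G Y) (hr : ∀ t, Reach Y t x (f t • x))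
    (hA : ∀ t v, flowD Y t x v = push E (f t) x (A t v)) (g : G) (t : ℝ) (v : E) :
    μ.len (flowMap Y t (g • x)) (flowD Y t (g • x) (push E g x v)) =
      μ.len ((g * f t) • x) (push E (g * f t) x (A t v)) := by
  rw [flowMap_smul F hY, flowD_smul F hY g (hr t), (hr t).flowMap_eq hY.smoothField, hA,
    push_mul_apply F, mul_smul]

/-- Bounds for the linear group at `x` are bounds for the linearized flow along the orbit. -/
theorem len_flowD_le (hY : IsInvariantVectorField G Y) (hr : ∀ t, Reach Y t x (f t • x))
    (hA : ∀ t v, flowD Y t x v = push E (f t) x (A t v)) (h : BoundedDistortion G μ x k K)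
    (hk : 0 < k) (hK : 0 < K) {t c : ℝ} (hc : 0 ≤ c) {V : M → Submodule ℝ E}
    (hV : ∀ g : G, V (g • x) = (V x).map (pushEquiv F E g x).toLinearMap)
    (hAV : ∀ v ∈ V x, ‖A t v‖ ≤ C * c * ‖v‖) (hC : 0 < C) (hy : y ∈ MulAction.orbit G x)
    {v : E} (hv : v ∈ V y) :
    μ.len (flowMap Y t y) (flowD Y t y v) ≤ K * C / k * c * μ.len y v := by
  obtain ⟨g, rfl⟩ := hy
  change v ∈ V (g • x) at hv
  rw [hV] at hv
  obtain ⟨u, hu, rfl⟩ := hv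
  change μ.len (flowMap Y t (g • x)) (flowD Y t (g • x) (push E g x u)) ≤
    K * C / k * c * μ.len (g • x) (push E g x u)
  rw [len_flowD_push F hY hr hA]
  refine (h _ _).2.trans ?_
  have h1 : K * ‖A t u‖ ≤ K * (C * c * ‖u‖) := by gcongr; exact hAV u hu
  have h2 : ‖u‖ ≤ μ.len (g • x) (push E g x u) / k := by
    rw [le_div_iff₀ hk, mul_comm]; exact (h g u).1
  calc _ ≤ _ := h1
    _ ≤ K * (C * c * (μ.len (g • x) (push E g x u) / k)) := by gcongr
    _ = _ := by ring

/-- Along the trajectory of `x`, lengths are comparable with `‖A t v‖`, so the decay criterion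
applies to the linear group with `b = 0`. -/
theorem decay_eq (hY : IsInvariantVectorField G Y) (hA0 : ∀ v, A 0 v = v)
    (hAa : ∀ s t v, A (s + t) v = A s (A t v)) (hr : ∀ t, Reach Y t x (f t • x))
    (hA : ∀ t v, flowD Y t x v = push E (f t) x (A t v)) (h : BoundedDistortion G μ x k K)
    (hk : 0 < k) (hK : 0 < K) (hC : 0 < C) (ha : 0 < a) {T S U : Submodule ℝ E}
    (htop : T ⊔ (S ⊔ U) = ⊤) (hT : ∀ t, ∀ v ∈ T, A t v ∈ T) (hU : ∀ t, ∀ v ∈ U, A t v ∈ U)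
    (hTc : ∀ t, ∀ v ∈ T, ‖A t v‖ ≤ C * ‖v‖)
    (hSc : ∀ t, 0 ≤ t → ∀ v ∈ S, ‖A (σ * t) v‖ ≤ C * Real.exp (-a * t) * ‖v‖)
    (hUc : ∀ t, 0 ≤ t → ∀ v ∈ U, ‖A (-(σ * t)) v‖ ≤ C * Real.exp (-a * t) * ‖v‖) :
    decay μ Y σ a x = S := by
  have hback : ∀ t v, A (-t) (A t v) = v := fun t v => by rw [← hAa, neg_add_cancel, hA0]
  ext v
  rw [mem_iff_exists_forall_le (ℓ := fun t v => ‖A (σ * t) v‖) (n := fun v => ‖v‖)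
    (fun v hv => norm_le_zero_iff.1 hv) (fun t v w => by rw [map_sub]; exact norm_sub_le _ _)
    htop hC le_rfl ha hSc (fun t ht v hv => ?_) (fun t ht v hv => ?_) (fun t ht v hv => ?_)]
  · have hlen : ∀ t, μ.len (flowMap Y t x) (flowD Y t x v) =
        μ.len (f t • x) (push E (f t) x (A t v)) := fun t => by
      rw [(hr t).flowMap_eq hY.smoothField, hA]
    simp only [mem_decay, hlen]
    constructor
    · rintro ⟨D, hD⟩
      refine ⟨D / k, fun t ht => ?_⟩
      rw [div_mul_eq_mul_div, le_div_iff₀ hk, mul_comm]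
      exact (h _ _).1.trans (hD t ht)
    · rintro ⟨D, hD⟩
      refine ⟨K * D, fun t ht => ?_⟩
      rw [mul_assoc]
      exact (h _ _).2.trans (mul_le_mul_of_nonneg_left (hD t ht) hK.le)
  · have := hUc t ht _ (hU (σ * t) v hv)
    rwa [hback] at this
  · simpa using hTc (σ * t) v hv
  · have := hTc (-(σ * t)) _ (hT (σ * t) v hv)
    rw [hback] at this
    simpa using this

theorem flowD_mem_decay (hY : IsInvariantVectorField G Y) (hx : IsRelativeEquilibrium F G Y x)
    (hr : ∀ t, Reach Y t x (f t • x))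
    (hA : ∀ t v, flowD Y t x v = push E (f t) x (A t v)) (h : BoundedDistortion G μ x k K)
    (hk : 0 < k) (hK : 0 < K) (hS : ∀ t, ∀ v ∈ decay μ Y σ a x, A t v ∈ decay μ Y σ a x)
    (hy : y ∈ MulAction.orbit G x) (t : ℝ) {v : E} (hv : v ∈ decay μ Y σ a y) :
    flowD Y t y v ∈ decay μ Y σ a (flowMap Y t y) := by
  obtain ⟨g, rfl⟩ := hy
  change v ∈ decay μ Y σ a (g • x) at hv
  rw [decay_smul hY hx h hk hK] at hv
  obtain ⟨u, hu, rfl⟩ := hv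
  change flowD Y t (g • x) (push E g x u) ∈ decay μ Y σ a (flowMap Y t (g • x))
  rw [flowMap_smul F hY, flowD_smul F hY g (hr t), (hr t).flowMap_eq hY.smoothField, hA,
    push_mul_apply F, ← mul_smul,
    push_mem_decay_iff hY hx h hk hK (MulAction.mem_orbit_self x)]
  exact hS t u hu

/-- The splitting of `X` need not be invariant under the flow of `Y`; it is corrected at `x` within
`T ⊔ P x` and `T ⊔ Q x` and then spread over the orbit. The metric and the rate `a` are kept. -/
theorem Isomorphic.isNormallyHyperbolicOrbit [ProperSMul G M] (hX : IsInvariantVectorField G X)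
    (hY : IsInvariantVectorField G Y) (hXY : Isomorphic F G X Y)
    (hcpt : IsCompact (MulAction.orbit G x)) (hnh : IsNormallyHyperbolicOrbit F G X x) :
    IsNormallyHyperbolicOrbit F G Y x := by
  obtain ⟨hx, μ, Es, Eu, C, a, b, hC, hb, hba, H⟩ := hnh
  have ha : 0 < a := hb.trans_lt hba
  have hxY : IsRelativeEquilibrium F G Y x := hXY.symm.isRelativeEquilibrium hx
  have := compactSpace_of_isCompact_orbit hcpt
  obtain ⟨k, hk, K, hK, h⟩ := μ.exists_len_push_bounds F G x
  replace h : BoundedDistortion G μ x k K := h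
  obtain ⟨K', hK', hK'T⟩ := μ.exists_len_infAct_le F G x
  obtain ⟨f, A, hA0, hAa, hr, hA⟩ := exists_linear_group hY hxY
  obtain ⟨c, hc, hAT⟩ := exists_linear_group_le hY hr hA h hk hK' hK'T
  let P : M → Submodule ℝ E := fun y => Es y
  let Q : M → Submodule ℝ E := fun y => Eu y
  have hPQ : ∀ y ∈ MulAction.orbit G x, Disjoint (P y) (Q y) := fun y hy => (H y hy).1
  have hcompl : ∀ y ∈ MulAction.orbit G x, IsCompl (orbitDir F G E y) (P y ⊔ Q y) :=
    fun y hy => (H y hy).2.1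
  have hPi : ∀ y ∈ MulAction.orbit G x, ∀ t, ∀ v ∈ P y, flowD X t y v ∈ P (flowMap X t y) :=
    fun y hy => (H y hy).2.2.1
  have hQi : ∀ y ∈ MulAction.orbit G x, ∀ t, ∀ v ∈ Q y, flowD X t y v ∈ Q (flowMap X t y) :=
    fun y hy => (H y hy).2.2.2.1
  have hPc : ∀ y ∈ MulAction.orbit G x, ∀ t, 0 ≤ t → ∀ v ∈ P y,
      μ.len (flowMap X t y) (flowD X t y v) ≤ C * Real.exp (-a * t) * μ.len y v :=
    fun y hy t ht v hv => (H y hy).2.2.2.2.1 t v hv ht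
  have hQc : ∀ y ∈ MulAction.orbit G x, ∀ t, 0 ≤ t → ∀ v ∈ Q y,
      μ.len (flowMap X (-t) y) (flowD X (-t) y v) ≤ C * Real.exp (-a * t) * μ.len y v :=
    fun y hy t ht v hv => (H y hy).2.2.2.2.2.1 t v hv ht
  have hTc : ∀ y ∈ MulAction.orbit G x, ∀ t, ∀ v ∈ orbitDir F G E y,
      μ.len (flowMap X t y) (flowD X t y v) ≤ C * Real.exp (b * |t|) * μ.len y v :=
    fun y hy => (H y hy).2.2.2.2.2.2
  have hx0 := MulAction.mem_orbit_self (M := G) x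
  have hgx : ∀ g : G, g • x ∈ MulAction.orbit G x := fun g => MulAction.mem_orbit x g
  have hPd : ∀ y ∈ MulAction.orbit G x, ∀ v, v ∈ P y ↔ v ∈ decay μ X 1 a y := fun y hy v =>
    mem_iff_mem_decay hX hx (by simp) hC hb hba (fun y hy => (hcompl y hy).sup_eq_top) hQi
      (by simpa using hPc) (by simpa using hQc) hTc hy
  have hQd : ∀ y ∈ MulAction.orbit G x, ∀ v, v ∈ Q y ↔ v ∈ decay μ X (-1) a y := fun y hy v =>
    mem_iff_mem_decay hX hx (by simp) hC hb hba
      (fun y hy => by rw [sup_comm (Q y)]; exact (hcompl y hy).sup_eq_top) hPi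
      (by simpa using hQc) (by simpa using hPc) hTc hy
  have hPg : ∀ (g : G) v, push E g x v ∈ P (g • x) ↔ v ∈ P x := fun g v => by
    rw [hPd _ (hgx g), hPd _ hx0, push_mem_decay_iff hX hx h hk hK hx0]
  have hQg : ∀ (g : G) v, push E g x v ∈ Q (g • x) ↔ v ∈ Q x := fun g v => by
    rw [hQd _ (hgx g), hQd _ hx0, push_mem_decay_iff hX hx h hk hK hx0]
  obtain ⟨S, hS1, hS2, hS3, c₁, hc₁, hS4⟩ := exists_contracted_complement (σ := 1) hX hY hXY hA0 hAa
    hr hA h hk hAT (by simp) ha hC ((hcompl x hx0).disjoint.mono_right le_sup_left) (hPi x hx0) hPg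
    (by simpa using hPc x hx0)
  obtain ⟨U, hU1, hU2, hU3, c₂, hc₂, hU4⟩ := exists_contracted_complement (σ := -1) hX hY hXY hA0
    hAa hr hA h hk hAT (by simp) ha hC ((hcompl x hx0).disjoint.mono_right le_sup_right)
    (hQi x hx0) hQg (by simpa using hQc x hx0)
  obtain ⟨hSU, hTSU⟩ :=
    disjoint_and_isCompl_of_sup_eq (hPQ x hx0) (hcompl x hx0) hS1 hU1 hS2 hU2
  let D := c + c₁ + c₂
  have hD : 0 < D := by positivity
  have hT5 : ∀ t, ∀ v ∈ orbitDir F G E x, ‖A t v‖ ≤ D * ‖v‖ := fun t v hv =>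
    (hAT t v hv).trans (mul_le_mul_of_nonneg_right (by simp only [D]; linarith) (norm_nonneg v))
  have hS5 : ∀ t, 0 ≤ t → ∀ v ∈ S, ‖A t v‖ ≤ D * Real.exp (-a * t) * ‖v‖ := fun t ht v hv => by
    have := hS4 t ht v hv
    rw [one_mul] at this
    refine this.trans ?_
    gcongr
    simp only [D]; linarith
  have hU5 : ∀ t, 0 ≤ t → ∀ v ∈ U, ‖A (-t) v‖ ≤ D * Real.exp (-a * t) * ‖v‖ := fun t ht v hv => by
    have := hU4 t ht v hv
    rw [neg_one_mul] at this
    refine this.trans ?_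
    gcongr
    simp only [D]; linarith
  have hTA : ∀ t, ∀ v ∈ orbitDir F G E x, A t v ∈ orbitDir F G E x :=
    fun t v hv => linear_group_mem hY hr hA t hv
  have hSd : decay μ Y 1 a x = S := decay_eq hY hA0 hAa hr hA h hk hK hD ha hTSU.sup_eq_top hTA hU3
    hT5 (by simpa using hS5) (by simpa using hU5)
  have hUd : decay μ Y (-1) a x = U := decay_eq hY hA0 hAa hr hA h hk hK hD ha
    (by rw [sup_comm U]; exact hTSU.sup_eq_top) hTA hS3 hT5 (by simpa using hU5)
    (by simpa using hS5)
  have hSg := fun g : G => decay_smul (σ := 1) (a := a) hY hxY h hk hK g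
  have hUg := fun g : G => decay_smul (σ := -1) (a := a) hY hxY h hk hK g
  -- Decay subspaces extend `S` and `U` over the orbit without choosing `g` in `y = g • x`. The
  -- tangential rate becomes `0`, because the linear group is bounded on orbit directions.
  refine ⟨hxY, μ, decay μ Y 1 a, decay μ Y (-1) a, K * D / k, a, 0, by positivity, le_rfl, ha,
    fun y hy => ⟨?_, ?_, fun t v hv => ?_, fun t v hv => ?_, fun t v hv ht => ?_,
      fun t v hv ht => ?_, fun t v hv => ?_⟩⟩
  · obtain ⟨g, rfl⟩ := hy
    change Disjoint (decay μ Y 1 a (g • x)) (decay μ Y (-1) a (g • x))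
    rw [hSg, hUg, hSd, hUd]
    exact (disjoint_map_orderIso_iff (Submodule.orderIsoMapComap (pushEquiv F E g x))).2 hSU
  · obtain ⟨g, rfl⟩ := hy
    change IsCompl (orbitDir F G E (g • x)) (decay μ Y 1 a (g • x) ⊔ decay μ Y (-1) a (g • x))
    rw [hSg, hUg, hSd, hUd, orbitDir_smul, ← Submodule.map_sup]
    exact (Submodule.orderIsoMapComap (pushEquiv F E g x)).isCompl hTSU
  · exact flowD_mem_decay hY hxY hr hA h hk hK (by rwa [hSd]) hy t hv
  · exact flowD_mem_decay hY hxY hr hA h hk hK (by rwa [hUd]) hy t hv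
  · exact len_flowD_le hY hr hA h hk hK (Real.exp_nonneg _) hSg
      (by rw [hSd]; exact hS5 t ht) hD hy hv
  · exact len_flowD_le hY hr hA h hk hK (Real.exp_nonneg _) hUg
      (by rw [hUd]; exact hU5 t ht) hD hy hv
  · exact len_flowD_le hY hr hA h hk hK (Real.exp_nonneg _) (fun g => orbitDir_smul g x)
      (by simpa using hT5 t) hD hy hv

end CompactOrbit

end EquivariantDynamics

theorem mainTheorem7
    {F : Type*} [NormedAddCommGroup F] [NormedSpace ℝ F] [FiniteDimensional ℝ F]
    {G : Type*} [TopologicalSpace G] [ChartedSpace F G] [Group G] [LieGroup 𝓘(ℝ, F) ∞ G]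
    {E : Type*} [NormedAddCommGroup E] [NormedSpace ℝ E] [FiniteDimensional ℝ E]
    {M : Type*} [TopologicalSpace M] [T2Space M] [SigmaCompactSpace M]
    [ChartedSpace E M] [IsManifold 𝓘(ℝ, E) ∞ M]
    [MulAction G M] [ContMDiffSMul 𝓘(ℝ, F) 𝓘(ℝ, E) ∞ G M] [ProperSMul G M]
    (X Y : (m : M) → TangentSpace 𝓘(ℝ, E) m)
    (hX : EquivariantDynamics.IsInvariantVectorField G X)
    (hY : EquivariantDynamics.IsInvariantVectorField G Y)
    (hXY : EquivariantDynamics.Isomorphic F G X Y) :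
    (∃ Ψ : ℝ → MulAction.orbitRel.Quotient G M →. MulAction.orbitRel.Quotient G M,
      EquivariantDynamics.InducesOnOrbitSpace G X Ψ ∧
      EquivariantDynamics.InducesOnOrbitSpace G Y Ψ) ∧
    (∀ x : M, EquivariantDynamics.IsRelativeEquilibrium F G X x ↔
      EquivariantDynamics.IsRelativeEquilibrium F G Y x) ∧
    (∀ P : Set M, EquivariantDynamics.IsRelativePeriodicOrbit F G X P ↔
      EquivariantDynamics.IsRelativePeriodicOrbit F G Y P) ∧
    (∀ x : M, EquivariantDynamics.IsHyperbolicRelativeEquilibrium F G X x ↔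
      EquivariantDynamics.IsHyperbolicRelativeEquilibrium F G Y x) ∧
    (∀ x : M, IsCompact (MulAction.orbit G x) →
      (EquivariantDynamics.IsNormallyHyperbolicOrbit F G X x ↔
        EquivariantDynamics.IsNormallyHyperbolicOrbit F G Y x)) := by
  have hYX := hXY.symm
  exact ⟨hXY.exists_inducesOnOrbitSpace hX hY,
    fun x => ⟨hYX.isRelativeEquilibrium, hXY.isRelativeEquilibrium⟩,
    fun P => ⟨hYX.isRelativePeriodicOrbit hY hX, hXY.isRelativePeriodicOrbit hX hY⟩,
    fun x => ⟨hXY.isHyperbolicRelativeEquilibrium hX hY, hYX.isHyperbolicRelativeEquilibrium hY hX⟩,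
    fun x hx => ⟨hXY.isNormallyHyperbolicOrbit hX hY hx, hYX.isNormallyHyperbolicOrbit hY hX hx⟩⟩
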